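/- Consider coordinates $(t,r,\theta,\phi)$ and the exterior $r>r_H>0$ of a stationary, axisymmetric, circular black hole with metric $$ds^2=-N^2dt^2+A^2dr^2+r^2B^2\{d\theta^2+\sin^2\theta\,(d\phi-\omega\,dt)^2\},$$ where $N,A,B>0$ and $\omega$ are functions of $(r,\theta)$ that are smooth (on the symmetry axis too) and invariant under $\theta\mapsto\pi-\theta$. Assume that $r=r_H$ is a regular null horizon generated by $X=\partial_t+\Omega_H\partial_\phi$: the functions $N^2$, $NA$, $B$, $\omega$ extend smoothly to $r=r_H$, with $N=0$, $NA>0$, $B>0$, $\omega=\Omega_H$ there. Assume that the coordinates are asymptotically mass centered: for some constants $M,J$, as $r\to\infty$, $$N=1-\frac Mr+O(r^{-2}),\quad A=1+\frac Mr+O(r^{-2}),\quad B=1+O(r^{-2}),\quad \omega=\frac{2J}{r^3}+O(r^{-4}).$$ Here and below, $O(r^{-k})$ (in particular the remainders of $\Phi$ and $\phi_0$) is uniform in $\theta$ and may be differentiated termwise up to twice (each $r$-derivative gains a factor $r^{-1}$). Let ${}^*RR=R_{\beta\alpha\gamma\delta}{}^*R^{\alpha\beta\gamma\delta}$ with ${}^*R^{\alpha\beta\gamma\delta}=\frac12\epsilon^{\gamma\delta\rho\sigma}R^{\alpha\beta}{}_{\rho\sigma}$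 and $\epsilon_{tr\theta\phi}=\sqrt{-g}$ be the Pontryagin density, and assume that it falls off at least as $r^{-5}$, uniformly in $\theta$. Let $\epsilon\in\mathbb R$ and let $\Phi(r,\theta)$ be a scalar, smooth for $r>r_H$, on the axis and up to the horizon $r=r_H$, that solves the dynamical Chern–Simons scalar equation $\Box\Phi+\epsilon\,{}^*RR=0$ and has an expansion $$\Phi=\frac{\mu_1(\theta)}r+\frac{\mu_2(\theta)}{r^2}+O(r^{-3}),$$ with $\mu_1,\mu_2$ regular (smooth on the sphere). Let $\mu_{(2,\ell)}=\frac{2\ell+1}2\int_0^\pi\mu_2(\theta)P_\ell(\cos\theta)\sin\theta\,d\theta$ be the $\ell$-th Legendre coefficient of $\mu_2$. Then: 1. $\mu_1(\theta)=0$ for all $\theta$, and $\mu_{(2,0)}=0$. 2. $\mu_2(\theta)=\mu_{(2,1)}P_1(\cos\theta)$, so that $\Phi=\dfrac{\mu_{(2,1)}P_1(\cos\theta)}{r^2}+O(r^{-3})$. 3. Let $\phi_0(r,\theta)$ be any solution of $\Box\phi_0=0$ for $r>r_H$ that is smooth on the axis and up to the horizon and satisfies $\phi_0=rP_1(\cos\theta)+\psi(\theta)+O(r^{-1})$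 for some regular $\psi$. Let $\Sigma$ be any hypersurface $t=h(r,\theta,\phi)$, $r>r_H$, with $h$ of class $C^1$, $2\pi$-periodic in $\phi$, and $\partial_\phi h$ bounded (for instance $t=\mathrm{const}$), with surface element $d\Sigma_\mu=\partial_\mu(t-h)\sqrt{-g}\,dr\,d\theta\,d\phi$. Then $\epsilon\,{}^*RR\,\phi_0\,X^\mu d\Sigma_\mu$ is absolutely integrable over $\Sigma$ and $$\mu_{(2,1)}=\frac{\epsilon}{4\pi}\int_\Sigma R_{\beta\alpha\gamma\delta}{}^*R^{\alpha\beta\gamma\delta}\,\phi_0\,X^\mu\,d\Sigma_\mu .$$ -/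

import Mathlib

open scoped ContDiff

noncomputable section

namespace DCS

/-! ## Lorentzian geometry in a coordinate chart of `ℝ⁴`

`g x` is the matrix of the metric components `g_{μν}` at the coordinate point `x`. -/

/-- The coordinate derivative `∂_μ f` at `x`. -/
def pd (μ : Fin 4) (f : (Fin 4 → ℝ) → ℝ) (x : Fin 4 → ℝ) : ℝ :=
  fderiv ℝ f x (Pi.single μ 1)

/-- `√(-det g)`. -/
def volDensity (g : (Fin 4 → ℝ) → Matrix (Fin 4) (Fin 4) ℝ) (x : Fin 4 → ℝ) : ℝ :=
  Real.sqrt (-(g x).det)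

/-- `□f = ∇_μ ∇^μ f = (1/√(-g)) ∂_μ (√(-g) g^{μν} ∂_ν f)`. -/
def box (g : (Fin 4 → ℝ) → Matrix (Fin 4) (Fin 4) ℝ) (f : (Fin 4 → ℝ) → ℝ)
    (x : Fin 4 → ℝ) : ℝ :=
  (1 / volDensity g x) *
    ∑ μ, pd μ (fun y => volDensity g y * ∑ ν, (g y)⁻¹ μ ν * pd ν f y) x

/-- The Christoffel symbol `Γ^l_{mn}`. -/
def christoffel (g : (Fin 4 → ℝ) → Matrix (Fin 4) (Fin 4) ℝ) (l m n : Fin 4)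
    (x : Fin 4 → ℝ) : ℝ :=
  (1 / 2) * ∑ s, (g x)⁻¹ l s *
    (pd m (fun y => g y s n) x + pd n (fun y => g y s m) x - pd s (fun y => g y m n) x)

/-- The Riemann tensor
`R^a_{bcd} = ∂_c Γ^a_{db} - ∂_d Γ^a_{cb} + Γ^a_{ce} Γ^e_{db} - Γ^a_{de} Γ^e_{cb}`. -/
def riemann (g : (Fin 4 → ℝ) → Matrix (Fin 4) (Fin 4) ℝ) (a b c d : Fin 4)
    (x : Fin 4 → ℝ) : ℝ :=
  pd c (christoffel g a d b) x - pd d (christoffel g a c b) x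
    + ∑ e, (christoffel g a c e x * christoffel g e d b x
      - christoffel g a d e x * christoffel g e c b x)

/-- `R_{abcd}`. -/
def riemannDown (g : (Fin 4 → ℝ) → Matrix (Fin 4) (Fin 4) ℝ) (a b c d : Fin 4)
    (x : Fin 4 → ℝ) : ℝ :=
  ∑ e, g x a e * riemann g e b c d x

/-- `R^{ab}_{cd}`. -/
def riemannUpUp (g : (Fin 4 → ℝ) → Matrix (Fin 4) (Fin 4) ℝ) (a b c d : Fin 4)
    (x : Fin 4 → ℝ) : ℝ :=
  ∑ e, (g x)⁻¹ b e * riemann g a e c d x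

/-- The totally antisymmetric symbol with `[0123] = 1`. -/
def leviCivitaSymbol (a b c d : Fin 4) : ℝ :=
  Matrix.det (fun i j : Fin 4 => if ![a, b, c, d] i = j then (1 : ℝ) else 0)

/-- The Levi-Civita tensor `ε^{abcd}`, oriented so that `ε_{0123} = √(-g)`, i.e.
`ε^{0123} = -1 / √(-g)`. -/
def leviCivitaTensor (g : (Fin 4 → ℝ) → Matrix (Fin 4) (Fin 4) ℝ) (a b c d : Fin 4)
    (x : Fin 4 → ℝ) : ℝ :=
  -leviCivitaSymbol a b c d / volDensity g x

/-- The dual `*R^{abcd} = (1/2) ε^{cdef} R^{ab}_{ef}`. -/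
def dualRiemann (g : (Fin 4 → ℝ) → Matrix (Fin 4) (Fin 4) ℝ) (a b c d : Fin 4)
    (x : Fin 4 → ℝ) : ℝ :=
  (1 / 2) * ∑ e, ∑ f, leviCivitaTensor g c d e f x * riemannUpUp g a b e f x

/-- The Pontryagin density `R_{bacd} *R^{abcd}`. -/
def pontryagin (g : (Fin 4 → ℝ) → Matrix (Fin 4) (Fin 4) ℝ) (x : Fin 4 → ℝ) : ℝ :=
  ∑ a, ∑ b, ∑ c, ∑ d, riemannDown g b a c d x * dualRiemann g a b c d x

/-! ## Regular functions of `(r, θ)` and expansions in `1/r`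

A function of the polar angle is regular on the sphere, axis included, exactly when it is the
restriction to `[0, π]` of a smooth even `2π`-periodic function on `ℝ`; all functions of `θ`
are therefore taken on `ℝ` with these symmetries. -/

/-- `f` is even and `2π`-periodic. -/
def AxisSymm (f : ℝ → ℝ) : Prop :=
  (∀ θ, f (-θ) = f θ) ∧ ∀ θ, f (θ + 2 * Real.pi) = f θ

/-- A regular (smooth) function of `θ` on the sphere. -/
def RegularAngular (f : ℝ → ℝ) : Prop :=
  ContDiff ℝ ∞ f ∧ AxisSymm f

/-- `f (r, θ)`, given for `r > rH`, is smooth and extends smoothly to `r = rH`, where it takes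
the values `b θ`. -/
def ExtendsSmoothly (rH : ℝ) (f : ℝ → ℝ → ℝ) (b : ℝ → ℝ) : Prop :=
  ∃ F : ℝ × ℝ → ℝ, ContDiff ℝ ∞ F ∧ (∀ r θ, rH < r → F (r, θ) = f r θ) ∧
    ∀ θ, F (rH, θ) = b θ

/-- A stationary axisymmetric scalar that is smooth on `r > rH`, on the axis, and up to and
including the horizon `r = rH`. -/
def RegularScalar (rH : ℝ) (f : ℝ → ℝ → ℝ) : Prop :=
  (∃ b, ExtendsSmoothly rH f b) ∧ ∀ r, rH < r → AxisSymm (f r)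

/-- `E = 𝒪(r^{-k})` as `r → ∞`, uniformly in `θ`, where the estimate may be differentiated
up to twice: `∂_r^i ∂_θ^j E = 𝒪(r^{-k-i})`. -/
def IsRemainder (k : ℕ) (E : ℝ → ℝ → ℝ) : Prop :=
  ∀ i j : ℕ, i + j ≤ 2 → ∃ C R : ℝ, 0 < R ∧ ∀ r θ : ℝ, R < r →
    |iteratedDeriv i (fun s => iteratedDeriv j (E s) θ) r| ≤ C / r ^ (k + i)

/-! ## Hartle–Thorne type black hole metrics, coordinates `x = (t, r, θ, φ)` -/

/-- The functions of `(r, θ)` in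
`ds² = -N² dt² + A² dr² + r² B² (dθ² + sin² θ (dφ - w dt)²)`. -/
structure HTMetric where
  N : ℝ → ℝ → ℝ
  A : ℝ → ℝ → ℝ
  B : ℝ → ℝ → ℝ
  w : ℝ → ℝ → ℝ

/-- The matrix of metric components. -/
def HTMetric.g (m : HTMetric) (x : Fin 4 → ℝ) : Matrix (Fin 4) (Fin 4) ℝ :=
  let r := x 1
  let θ := x 2
  let S := r ^ 2 * m.B r θ ^ 2 * Real.sin θ ^ 2
  !![-m.N r θ ^ 2 + S * m.w r θ ^ 2, 0, 0, -(S * m.w r θ);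
     0, m.A r θ ^ 2, 0, 0;
     0, 0, r ^ 2 * m.B r θ ^ 2, 0;
     -(S * m.w r θ), 0, 0, S]

/-- The exterior of the horizon, without the axis (where the coordinates degenerate). -/
def exterior (rH : ℝ) : Set (Fin 4 → ℝ) :=
  {x | rH < x 1 ∧ 0 < x 2 ∧ x 2 < Real.pi}

/-- The exterior `r > rH` of a black hole: the metric is Lorentzian and regular on the axis and
symmetric under the reflection `θ ↦ π - θ`, and `r = rH` is a regular horizon, i.e. `N²`, `N A`
(hence the volume density), `B` and `w` extend smoothly to `r = rH`, the volume density
being nonzero there, and `X = ∂_t + ΩH ∂_φ` is its null generator: `N = 0` and `w = ΩH`. -/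
structure IsBlackHole (m : HTMetric) (rH ΩH : ℝ) : Prop where
  rH_pos : 0 < rH
  pos : ∀ r θ, rH < r → 0 < m.N r θ ∧ 0 < m.A r θ ∧ 0 < m.B r θ
  axis : ∀ r, rH < r →
    AxisSymm (m.N r) ∧ AxisSymm (m.A r) ∧ AxisSymm (m.B r) ∧ AxisSymm (m.w r)
  reflection : ∀ r θ, rH < r →
    m.N r (Real.pi - θ) = m.N r θ ∧ m.A r (Real.pi - θ) = m.A r θ ∧
    m.B r (Real.pi - θ) = m.B r θ ∧ m.w r (Real.pi - θ) = m.w r θ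
  horizon_N : ExtendsSmoothly rH (fun r θ => m.N r θ ^ 2) (fun _ => 0)
  horizon_NA : ∃ b, ExtendsSmoothly rH (fun r θ => m.N r θ * m.A r θ) b ∧ ∀ θ, 0 < b θ
  horizon_B : ∃ b, ExtendsSmoothly rH m.B b ∧ ∀ θ, 0 < b θ
  horizon_w : ExtendsSmoothly rH m.w (fun _ => ΩH)

/-- The coordinates are asymptotically mass centered, with mass `M` and angular momentum `J`. -/
structure IsAMC (m : HTMetric) (M J : ℝ) : Prop where
  N_exp : IsRemainder 2 (fun r θ => m.N r θ - (1 - M / r))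
  A_exp : IsRemainder 2 (fun r θ => m.A r θ - (1 + M / r))
  B_exp : IsRemainder 2 (fun r θ => m.B r θ - 1)
  w_exp : IsRemainder 4 (fun r θ => m.w r θ - 2 * J / r ^ 3)

/-- A curvature scalar falls off at least as `r^{-5}`. -/
def FallsOff (rH : ℝ) (S : (Fin 4 → ℝ) → ℝ) : Prop :=
  ∃ C R : ℝ, 0 < R ∧ ∀ x ∈ exterior rH, R < x 1 → |S x| ≤ C / x 1 ^ 5

/-- A function of `(r, θ)` as a stationary axisymmetric function on spacetime. -/
def lift (f : ℝ → ℝ → ℝ) (x : Fin 4 → ℝ) : ℝ := f (x 1) (x 2)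

/-- `□Φ + ε *RR = 0` outside the horizon. -/
def SolvesDCS (m : HTMetric) (rH ε : ℝ) (Φ : ℝ → ℝ → ℝ) : Prop :=
  ∀ x ∈ exterior rH, box m.g (lift Φ) x + ε * pontryagin m.g x = 0

/-- The Legendre polynomial `P_l`, by Rodrigues' formula. -/
def legendreP (l : ℕ) (ξ : ℝ) : ℝ :=
  iteratedDeriv l (fun y => (y ^ 2 - 1) ^ l) ξ / (2 ^ l * (l.factorial : ℝ))

/-- The coefficient of `P_l (cos θ)` in the Legendre expansion of `f`. -/
def mode (l : ℕ) (f : ℝ → ℝ) : ℝ :=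
  (2 * (l : ℝ) + 1) / 2 *
    ∫ θ in (0 : ℝ)..Real.pi, f θ * legendreP l (Real.cos θ) * Real.sin θ

/-- `φ₀` is a stationary axisymmetric solution of `□φ₀ = 0` that is regular at the horizon and
has an expansion in powers of `1/r` with leading term `r P₁(cos θ)`. -/
structure IsGreenSolution (m : HTMetric) (rH : ℝ) (φ₀ : ℝ → ℝ → ℝ) : Prop where
  regular : RegularScalar rH φ₀
  homogeneous : ∀ x ∈ exterior rH, box m.g (lift φ₀) x = 0
  expansion : ∃ ψ : ℝ → ℝ, RegularAngular ψ ∧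
    IsRemainder 1 (fun r θ => φ₀ r θ - (r * legendreP 1 (Real.cos θ) + ψ θ))

/-! ## Integrals over hypersurfaces from the horizon to spatial infinity -/

/-- The hypersurface `Σ : t = h (r, θ, φ)`, `r > rH`. No causal condition is needed, so this
covers all partial Cauchy surfaces of this form, `t = const` among them. -/
structure IsSlice (rH : ℝ) (h : ℝ → ℝ → ℝ → ℝ) : Prop where
  smooth : ContDiffOn ℝ 1 (fun p : ℝ × ℝ × ℝ => h p.1 p.2.1 p.2.2)
    (Set.Ioi rH ×ˢ Set.Ioo 0 Real.pi ×ˢ Set.univ)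
  periodic : ∀ r θ φ, h r θ (φ + 2 * Real.pi) = h r θ φ
  bounded : ∃ K, ∀ r θ φ, rH < r → 0 < θ → θ < Real.pi → |deriv (h r θ) φ| ≤ K

/-- Parameter domain `(r, θ, φ)` of the hypersurface. -/
def sliceDomain (rH : ℝ) : Set (ℝ × ℝ × ℝ) :=
  Set.Ioi rH ×ˢ Set.Ioo 0 Real.pi ×ˢ Set.Ioo 0 (2 * Real.pi)

/-- The point of `Σ` with parameters `(r, θ, φ)`. -/
def slicePoint (h : ℝ → ℝ → ℝ → ℝ) (p : ℝ × ℝ × ℝ) : Fin 4 → ℝ :=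
  ![h p.1 p.2.1 p.2.2, p.1, p.2.1, p.2.2]

/-- Density of the surface element, `dΣ_μ = ∂_μ (t - h) √(-g) dr dθ dφ`. -/
def surfaceElement (g : (Fin 4 → ℝ) → Matrix (Fin 4) (Fin 4) ℝ) (h : ℝ → ℝ → ℝ → ℝ)
    (μ : Fin 4) (x : Fin 4 → ℝ) : ℝ :=
  pd μ (fun y => y 0 - h (y 1) (y 2) (y 3)) x * volDensity g x

/-- The integrand of `∫_Σ S X^μ dΣ_μ` in `dr dθ dφ`, with `X = ∂_t + ΩH ∂_φ`. -/
def fluxDensity (g : (Fin 4 → ℝ) → Matrix (Fin 4) (Fin 4) ℝ) (ΩH : ℝ)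
    (h : ℝ → ℝ → ℝ → ℝ) (S : (Fin 4 → ℝ) → ℝ) (p : ℝ × ℝ × ℝ) : ℝ :=
  S (slicePoint h p) *
    ∑ μ, (![1, 0, 0, ΩH] : Fin 4 → ℝ) μ * surfaceElement g h μ (slicePoint h p)

end DCS

end

/-! On functions of `(r, θ)` the wave operator has divergence form: `√(-g) □f = ∂_r (P sin θ ∂_r f)
+ ∂_θ (Q sin θ ∂_θ f)`, with `P = N r² B² / A` and `Q = N A`. Since `P = N² r² B² / (N A)`, it
extends smoothly to the horizon and vanishes there, while `sin θ` vanishes on the axis. Green's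
identity on `rH ≤ r ≤ R` therefore has a single boundary term, the flux through the sphere `r = R`:
for a regular `v` with `□v = 0`, the integral of `ε √(-g) *RR v` equals minus the flux of `v ∂_r Φ -
Φ ∂_r v` (`exists_source_density`). Everything is read off from the limit `R → ∞`.

At infinity a term `c(θ) r^{-k}` of `Φ` contributes `Δc + k (k - 1) c` at its own order, `Δ` being
the Laplacian of the sphere. The source, of order `r^{-5}`, is too small to matter for `k ≤ 2`
(`leading_equation`). For `k = 1` this gives `Δμ₁ = 0`, so `μ₁` is constant. The constant is the
flux for `v = 1`, up to a factor, and it vanishes: `*RR` is a pseudoscalar, hence odd under `θ ↦ π -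
θ`, so its integral over each sphere is zero (`MetricInvariant.pontryagin`,
`leading_coefficient_zero`). With `μ₁ = 0` the order `k = 2` becomes leading and gives `Δμ₂ + 2 μ₂ =
0`, whose regular axisymmetric solutions are `c cos θ`.

For `v = φ₀ ~ r cos θ` the flux tends to `-3c ∫ cos² θ sin θ dθ = -2c` (`tendsto_dipole_flux`), so
the source has total integral `2c` over `(r, θ)`. On a slice `t = h` one has `X^μ dΣ_μ = (1 - ΩH ∂_φ
h) √(-g) dr dθ dφ`. Periodicity of `h` gives this weight mean one in `φ`, so the slice contributes
only a factor `2π` (`integral_sliceDomain`), whence `4π c`. Convergence is absolute because the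
source density is continuous up to the horizon and `O(r^{-2})` at infinity (`exists_source_bound`).
-/

open Filter Topology

namespace DCS

/-! ## Behaviour under the reflection `θ ↦ π - θ` -/

/-- The reflection `θ ↦ π - θ` of the coordinates `(t, r, θ, φ)`. -/
noncomputable def reflect (x : Fin 4 → ℝ) : Fin 4 → ℝ := fun i => if i = 2 then Real.pi - x 2 else x i

/-- The sign of a component of a covector under `reflect`. -/
noncomputable def reflSign (i : Fin 4) : ℝ := if i = 2 then -1 else 1

lemma reflSign_mul_self (i : Fin 4) : reflSign i * reflSign i = 1 := by
  unfold reflSign; split_ifs <;> norm_num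

/-- `f` has parity `σ` under the reflection, on `r > rH`. -/
def HasParity (rH σ : ℝ) (f : (Fin 4 → ℝ) → ℝ) : Prop :=
  ∀ x, rH < x 1 → f (reflect x) = σ * f x

lemma eventually_radius_gt {rH : ℝ} {x : Fin 4 → ℝ} (hx : rH < x 1) :
    ∀ᶠ y in 𝓝 x, rH < y 1 :=
  (continuous_apply 1).continuousAt.eventually (lt_mem_nhds hx)

/-- The linear part of `reflect`. -/
noncomputable def reflectLin : (Fin 4 → ℝ) ≃L[ℝ] (Fin 4 → ℝ) :=
  ContinuousLinearEquiv.piCongrRight fun i =>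
    if i = 2 then ContinuousLinearEquiv.neg ℝ else ContinuousLinearEquiv.refl ℝ ℝ

lemma reflectLin_apply (x : Fin 4 → ℝ) (i : Fin 4) : reflectLin x i = reflSign i * x i := by
  simp only [reflectLin, reflSign, ContinuousLinearEquiv.piCongrRight_apply]
  split_ifs <;> simp

lemma reflect_eq (x : Fin 4 → ℝ) : reflect x = reflectLin x + Pi.single 2 Real.pi := by
  ext i
  rw [Pi.add_apply, reflectLin_apply]
  unfold reflect reflSign
  split_ifs with h
  · subst h; simp; ring
  · simp [h]

lemma reflectLin_single (i : Fin 4) :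
    reflectLin (Pi.single i 1) = reflSign i • (Pi.single i 1 : Fin 4 → ℝ) := by
  ext j
  rw [reflectLin_apply]
  by_cases h : j = i
  · subst h; simp
  · simp [h]

/-- Chain rule for an affine involution. No differentiability of `f` is needed: composing with a
linear equivalence and multiplying by `±1` commute with `fderiv` even at its default value, so the
rule also covers the axis, where the coordinates degenerate. -/
lemma HasParity.pd {rH σ : ℝ} {f : (Fin 4 → ℝ) → ℝ} (hσ : σ * σ = 1) (hf : HasParity rH σ f)
    (i : Fin 4) : HasParity rH (reflSign i * σ) (pd i f) := by
  intro x hx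
  have h1 : (fun y => f (reflect y)) =ᶠ[𝓝 x] fun y => σ * f y :=
    (eventually_radius_gt hx).mono fun y hy => hf y hy
  have h2 : (fun y => f (reflect y)) = (fun z => f (z + Pi.single 2 Real.pi)) ∘ reflectLin := by
    ext y; simp [reflect_eq]
  have h3 : fderiv ℝ (fun y => f (reflect y)) x
      = (fderiv ℝ f (reflect x)).comp (reflectLin : (Fin 4 → ℝ) →L[ℝ] (Fin 4 → ℝ)) := by
    rw [h2, ContinuousLinearEquiv.comp_right_fderiv, fderiv_comp_add_right, reflect_eq]
  have h4 : fderiv ℝ (fun y => σ * f y) x = σ • fderiv ℝ f x := by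
    rcases mul_self_eq_one_iff.1 hσ with rfl | rfl
    · simp
    · ext v; simp [fderiv_fun_neg]
  have h5 := congrArg (fun L => L (Pi.single i 1)) (h3.symm.trans (h1.fderiv_eq.trans h4))
  simp only [ContinuousLinearMap.comp_apply, ContinuousLinearEquiv.coe_coe, reflectLin_single,
    map_smul, smul_eq_mul, smul_apply] at h5
  unfold DCS.pd
  have := reflSign_mul_self i
  linear_combination reflSign i * h5 - (fderiv ℝ f (reflect x)) (Pi.single i 1) * this

/-- The components of `g` transform as those of a tensor invariant under the reflection. -/
def MetricInvariant (rH : ℝ) (g : (Fin 4 → ℝ) → Matrix (Fin 4) (Fin 4) ℝ) : Prop :=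
  ∀ i j, HasParity rH (reflSign i * reflSign j) (fun x => g x i j)

lemma MetricInvariant.eq_conj {rH : ℝ} {g : (Fin 4 → ℝ) → Matrix (Fin 4) (Fin 4) ℝ}
    (hg : MetricInvariant rH g) {x : Fin 4 → ℝ} (hx : rH < x 1) :
    g (reflect x) = Matrix.diagonal reflSign * g x * Matrix.diagonal reflSign := by
  ext i j
  rw [Matrix.mul_diagonal, Matrix.diagonal_mul]
  have := hg i j x hx
  simp only at this
  rw [this]; ring

lemma diagonal_reflSign_mul_self :
    Matrix.diagonal reflSign * Matrix.diagonal reflSign = 1 := by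
  rw [Matrix.diagonal_mul_diagonal, ← Matrix.diagonal_one]
  congr 1; ext i; exact reflSign_mul_self i

/-- Inversion of the conjugation `g ↦ D g D` with `D² = 1`. The product rule for matrix inverses
holds for singular matrices too, so `g` need not be invertible. -/
lemma MetricInvariant.inv {rH : ℝ} {g : (Fin 4 → ℝ) → Matrix (Fin 4) (Fin 4) ℝ}
    (hg : MetricInvariant rH g) : MetricInvariant rH (fun x => (g x)⁻¹) := by
  intro i j x hx
  have hD : (Matrix.diagonal reflSign)⁻¹ = Matrix.diagonal reflSign :=
    Matrix.inv_eq_right_inv diagonal_reflSign_mul_self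
  simp only
  rw [hg.eq_conj hx, Matrix.mul_inv_rev, Matrix.mul_inv_rev, hD, ← mul_assoc,
    Matrix.mul_diagonal, Matrix.diagonal_mul]
  ring

lemma MetricInvariant.volDensity {rH : ℝ} {g : (Fin 4 → ℝ) → Matrix (Fin 4) (Fin 4) ℝ}
    (hg : MetricInvariant rH g) {x : Fin 4 → ℝ} (hx : rH < x 1) :
    volDensity g (reflect x) = volDensity g x := by
  have h := congrArg Matrix.det diagonal_reflSign_mul_self
  rw [Matrix.det_mul, Matrix.det_one] at h
  unfold DCS.volDensity
  rw [hg.eq_conj hx, Matrix.det_mul, Matrix.det_mul]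
  congr 2
  linear_combination (g x).det * h

lemma reflSign_sq (i : Fin 4) : reflSign i ^ 2 = 1 := by rw [sq, reflSign_mul_self]

/-- Each free index carries its sign and each contracted index carries it twice, where it squares to
one. The same count drives the curvature lemmas that follow. -/
lemma MetricInvariant.christoffel {rH : ℝ} {g : (Fin 4 → ℝ) → Matrix (Fin 4) (Fin 4) ℝ}
    (hg : MetricInvariant rH g) (l m n : Fin 4) :
    HasParity rH (reflSign l * reflSign m * reflSign n) (christoffel g l m n) := by
  intro x hx
  have hsq : ∀ i j : Fin 4, reflSign i * reflSign j * (reflSign i * reflSign j) = 1 := fun i j => by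
    linear_combination reflSign j ^ 2 * reflSign_sq i + reflSign_sq j
  have hpd := fun a b c => (hg b c).pd (hsq b c) a x hx
  have hinv := fun a b => hg.inv a b x hx
  simp only at hinv
  unfold DCS.christoffel
  simp only [hpd, hinv, Finset.mul_sum]
  refine Finset.sum_congr rfl fun s _ => ?_
  linear_combination (1 / 2) * (reflSign l * (g x)⁻¹ l s * reflSign m * reflSign n *
    (DCS.pd m (fun y => g y s n) x + DCS.pd n (fun y => g y s m) x
      - DCS.pd s (fun y => g y m n) x)) * reflSign_sq s

lemma MetricInvariant.riemann {rH : ℝ} {g : (Fin 4 → ℝ) → Matrix (Fin 4) (Fin 4) ℝ}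
    (hg : MetricInvariant rH g) (a b c d : Fin 4) :
    HasParity rH (reflSign a * reflSign b * reflSign c * reflSign d) (riemann g a b c d) := by
  intro x hx
  have hsq : ∀ i j k : Fin 4,
      reflSign i * reflSign j * reflSign k * (reflSign i * reflSign j * reflSign k) = 1 :=
    fun i j k => by
      linear_combination reflSign j ^ 2 * reflSign k ^ 2 * reflSign_sq i
        + reflSign k ^ 2 * reflSign_sq j + reflSign_sq k
  have hpd := fun a b c d => (hg.christoffel b c d).pd (hsq b c d) a x hx
  have hch := fun a b c => hg.christoffel a b c x hx
  unfold DCS.riemann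
  simp only [hpd, hch, mul_add, Finset.mul_sum]
  refine congrArg₂ _ (by ring) (Finset.sum_congr rfl fun e _ => ?_)
  linear_combination reflSign a * reflSign b * reflSign c * reflSign d *
    (DCS.christoffel g a c e x * DCS.christoffel g e d b x
      - DCS.christoffel g a d e x * DCS.christoffel g e c b x) * reflSign_sq e

lemma MetricInvariant.riemannDown {rH : ℝ} {g : (Fin 4 → ℝ) → Matrix (Fin 4) (Fin 4) ℝ}
    (hg : MetricInvariant rH g) (a b c d : Fin 4) :
    HasParity rH (reflSign a * reflSign b * reflSign c * reflSign d) (riemannDown g a b c d) := by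
  intro x hx
  have h1 := fun a b => hg a b x hx
  have h2 := fun a b c d => hg.riemann a b c d x hx
  simp only at h1
  unfold DCS.riemannDown
  simp only [h1, h2, Finset.mul_sum]
  refine Finset.sum_congr rfl fun e _ => ?_
  linear_combination reflSign a * reflSign b * reflSign c * reflSign d *
    (g x a e * DCS.riemann g e b c d x) * reflSign_sq e

lemma MetricInvariant.riemannUpUp {rH : ℝ} {g : (Fin 4 → ℝ) → Matrix (Fin 4) (Fin 4) ℝ}
    (hg : MetricInvariant rH g) (a b c d : Fin 4) :
    HasParity rH (reflSign a * reflSign b * reflSign c * reflSign d) (riemannUpUp g a b c d) := by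
  intro x hx
  have h1 := fun a b => hg.inv a b x hx
  have h2 := fun a b c d => hg.riemann a b c d x hx
  simp only at h1
  unfold DCS.riemannUpUp
  simp only [h1, h2, Finset.mul_sum]
  refine Finset.sum_congr rfl fun e _ => ?_
  linear_combination reflSign a * reflSign b * reflSign c * reflSign d *
    ((g x)⁻¹ b e * DCS.riemann g a e c d x) * reflSign_sq e

/-- The index matrix intertwines the diagonal matrix of the chosen signs with that of all four
signs. Taking determinants leaves `det D = -1` on one side, and repeated indices need no separate
case. -/
lemma reflSign_mul_leviCivitaSymbol (a b c d : Fin 4) :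
    reflSign a * reflSign b * reflSign c * reflSign d * leviCivitaSymbol a b c d
      = -leviCivitaSymbol a b c d := by
  set M : Matrix (Fin 4) (Fin 4) ℝ :=
    fun i j : Fin 4 => if ![a, b, c, d] i = j then (1 : ℝ) else 0 with hM
  have h : Matrix.diagonal (fun i => reflSign (![a, b, c, d] i)) * M
      = M * Matrix.diagonal reflSign := by
    ext i j
    rw [Matrix.mul_diagonal, Matrix.diagonal_mul, hM]
    by_cases hij : ![a, b, c, d] i = j
    · simp [hij]
    · simp [hij]
  have h2 := congrArg Matrix.det h
  rw [Matrix.det_mul, Matrix.det_mul, Matrix.det_diagonal, Matrix.det_diagonal] at h2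
  have h3 : ∏ i, reflSign i = -1 := by simp [reflSign]
  rw [h3, Fin.prod_univ_four] at h2
  unfold leviCivitaSymbol
  simpa using h2

lemma MetricInvariant.leviCivitaTensor {rH : ℝ} {g : (Fin 4 → ℝ) → Matrix (Fin 4) (Fin 4) ℝ}
    (hg : MetricInvariant rH g) (a b c d : Fin 4) :
    HasParity rH (-(reflSign a * reflSign b * reflSign c * reflSign d))
      (leviCivitaTensor g a b c d) := by
  intro x hx
  unfold DCS.leviCivitaTensor
  rw [hg.volDensity hx]
  linear_combination (1 / DCS.volDensity g x) * -reflSign_mul_leviCivitaSymbol a b c d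

lemma MetricInvariant.dualRiemann {rH : ℝ} {g : (Fin 4 → ℝ) → Matrix (Fin 4) (Fin 4) ℝ}
    (hg : MetricInvariant rH g) (a b c d : Fin 4) :
    HasParity rH (-(reflSign a * reflSign b * reflSign c * reflSign d))
      (dualRiemann g a b c d) := by
  intro x hx
  have h1 := fun a b c d => hg.leviCivitaTensor a b c d x hx
  have h2 := fun a b c d => hg.riemannUpUp a b c d x hx
  unfold DCS.dualRiemann
  simp only [h1, h2, Finset.mul_sum]
  refine Finset.sum_congr rfl fun e _ => Finset.sum_congr rfl fun f _ => ?_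
  linear_combination -(1 / 2) * reflSign a * reflSign b * reflSign c * reflSign d *
    (DCS.leviCivitaTensor g c d e f x * DCS.riemannUpUp g a b e f x) *
    (reflSign f ^ 2 * reflSign_sq e + reflSign_sq f)

/-- The Pontryagin density is a pseudoscalar. -/
lemma MetricInvariant.pontryagin {rH : ℝ} {g : (Fin 4 → ℝ) → Matrix (Fin 4) (Fin 4) ℝ}
    (hg : MetricInvariant rH g) : HasParity rH (-1) (pontryagin g) := by
  intro x hx
  have h1 := fun a b c d => hg.riemannDown a b c d x hx
  have h2 := fun a b c d => hg.dualRiemann a b c d x hx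
  unfold DCS.pontryagin
  simp only [h1, h2, Finset.mul_sum]
  refine Finset.sum_congr rfl fun a _ => Finset.sum_congr rfl fun b _ =>
    Finset.sum_congr rfl fun c _ => Finset.sum_congr rfl fun d _ => ?_
  linear_combination -(DCS.riemannDown g b a c d x * DCS.dualRiemann g a b c d x) *
    (reflSign b ^ 2 * reflSign c ^ 2 * reflSign d ^ 2 * reflSign_sq a
      + reflSign c ^ 2 * reflSign d ^ 2 * reflSign_sq b
      + reflSign d ^ 2 * reflSign_sq c + reflSign_sq d)

lemma IsBlackHole.metricInvariant {m : HTMetric} {rH ΩH : ℝ} (hm : IsBlackHole m rH ΩH) :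
    MetricInvariant rH m.g := by
  intro i j x hx
  obtain ⟨hN, hA, hB, hw⟩ := hm.reflection (x 1) (x 2) hx
  have h1 : reflect x 1 = x 1 := by simp [reflect]
  have h2 : reflect x 2 = Real.pi - x 2 := by simp [reflect]
  simp only [HTMetric.g, h1, h2, hN, hA, hB, hw, Real.sin_pi_sub]
  fin_cases i <;> fin_cases j <;> simp [reflSign]

/-! ## The wave operator on stationary axisymmetric functions -/

/-- `∂_r H` for a function of `(r, θ)`. -/
noncomputable def dR (H : ℝ × ℝ → ℝ) (p : ℝ × ℝ) : ℝ := fderiv ℝ H p (1, 0)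

/-- `∂_θ H` for a function of `(r, θ)`. -/
noncomputable def dTheta (H : ℝ × ℝ → ℝ) (p : ℝ × ℝ) : ℝ := fderiv ℝ H p (0, 1)

/-- `√(-g) g^{rr} / sin θ`. -/
noncomputable def HTMetric.radialCoeff (m : HTMetric) (p : ℝ × ℝ) : ℝ :=
  m.N p.1 p.2 * p.1 ^ 2 * m.B p.1 p.2 ^ 2 / m.A p.1 p.2

/-- `√(-g) g^{θθ} / sin θ`. -/
noncomputable def HTMetric.angularCoeff (m : HTMetric) (p : ℝ × ℝ) : ℝ :=
  m.N p.1 p.2 * m.A p.1 p.2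

/-- The `r`-component of the vector density `√(-g) ∇f`. -/
noncomputable def HTMetric.radialFlux (m : HTMetric) (H : ℝ × ℝ → ℝ) (p : ℝ × ℝ) : ℝ :=
  m.radialCoeff p * Real.sin p.2 * dR H p

/-- The `θ`-component of the vector density `√(-g) ∇f`. -/
noncomputable def HTMetric.angularFlux (m : HTMetric) (H : ℝ × ℝ → ℝ) (p : ℝ × ℝ) : ℝ :=
  m.angularCoeff p * Real.sin p.2 * dTheta H p

lemma hasFDerivAt_comp_polar {H : ℝ × ℝ → ℝ} {x : Fin 4 → ℝ}
    (hH : DifferentiableAt ℝ H (x 1, x 2)) :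
    HasFDerivAt (fun y : Fin 4 → ℝ => H (y 1, y 2))
      ((fderiv ℝ H (x 1, x 2)).comp
        ((ContinuousLinearMap.proj 1 : (Fin 4 → ℝ) →L[ℝ] ℝ).prod
          (ContinuousLinearMap.proj 2))) x :=
  HasFDerivAt.comp (g := H) x hH.hasFDerivAt
    (((ContinuousLinearMap.proj 1 : (Fin 4 → ℝ) →L[ℝ] ℝ).prod
      (ContinuousLinearMap.proj 2)).hasFDerivAt)

lemma pd_comp_polar {H : ℝ × ℝ → ℝ} {x : Fin 4 → ℝ}
    (hH : DifferentiableAt ℝ H (x 1, x 2)) :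
    pd 0 (fun y : Fin 4 → ℝ => H (y 1, y 2)) x = 0 ∧
    pd 1 (fun y : Fin 4 → ℝ => H (y 1, y 2)) x = dR H (x 1, x 2) ∧
    pd 2 (fun y : Fin 4 → ℝ => H (y 1, y 2)) x = dTheta H (x 1, x 2) ∧
    pd 3 (fun y : Fin 4 → ℝ => H (y 1, y 2)) x = 0 := by
  unfold pd dR dTheta
  rw [(hasFDerivAt_comp_polar hH).fderiv]
  refine ⟨?_, by simp, by simp, ?_⟩ <;> · simp; exact map_zero _

lemma isOpen_exterior (rH : ℝ) : IsOpen (exterior rH) := by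
  have h1 := continuous_apply (A := fun _ : Fin 4 => ℝ) 1
  have h2 := continuous_apply (A := fun _ : Fin 4 => ℝ) 2
  exact (isOpen_lt continuous_const h1).inter
    ((isOpen_lt continuous_const h2).inter (isOpen_lt h2 continuous_const))

lemma IsBlackHole.radius_pos {m : HTMetric} {rH ΩH r : ℝ} (hm : IsBlackHole m rH ΩH)
    (hr : rH < r) : 0 < r := hm.rH_pos.trans hr

lemma IsBlackHole.volDensity_eq {m : HTMetric} {rH ΩH : ℝ} (hm : IsBlackHole m rH ΩH)
    {x : Fin 4 → ℝ} (hr : rH < x 1) :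
    volDensity m.g x
      = m.N (x 1) (x 2) * m.A (x 1) (x 2) * x 1 ^ 2 * m.B (x 1) (x 2) ^ 2
          * |Real.sin (x 2)| := by
  obtain ⟨hN, hA, hB⟩ := hm.pos (x 1) (x 2) hr
  have hr0 := hm.radius_pos hr
  have hdet : -(m.g x).det = (m.N (x 1) (x 2) * m.A (x 1) (x 2) * x 1 ^ 2 * m.B (x 1) (x 2) ^ 2
      * |Real.sin (x 2)|) ^ 2 := by
    rw [mul_pow, sq_abs]
    simp [HTMetric.g, Matrix.det_succ_row_zero, Fin.sum_univ_succ, Fin.succAbove]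
    ring
  unfold volDensity
  rw [hdet, Real.sqrt_sq (by positivity)]

lemma IsBlackHole.inv_g {m : HTMetric} {rH ΩH : ℝ} (hm : IsBlackHole m rH ΩH)
    {x : Fin 4 → ℝ} (hx : x ∈ exterior rH) :
    (m.g x)⁻¹ = !![-1 / m.N (x 1) (x 2) ^ 2, 0, 0, -m.w (x 1) (x 2) / m.N (x 1) (x 2) ^ 2;
      0, 1 / m.A (x 1) (x 2) ^ 2, 0, 0;
      0, 0, 1 / (x 1 ^ 2 * m.B (x 1) (x 2) ^ 2), 0;
      -m.w (x 1) (x 2) / m.N (x 1) (x 2) ^ 2, 0, 0,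
        1 / (x 1 ^ 2 * m.B (x 1) (x 2) ^ 2 * Real.sin (x 2) ^ 2)
          - m.w (x 1) (x 2) ^ 2 / m.N (x 1) (x 2) ^ 2] := by
  obtain ⟨hN, hA, hB⟩ := hm.pos (x 1) (x 2) hx.1
  have hr0 := (hm.radius_pos hx.1).ne'
  have hs := (Real.sin_pos_of_pos_of_lt_pi hx.2.1 hx.2.2).ne'
  have hN' := hN.ne'
  have hA' := hA.ne'
  have hB' := hB.ne'
  apply Matrix.inv_eq_right_inv
  ext i j
  fin_cases i <;> fin_cases j <;>
    simp [HTMetric.g, Matrix.mul_apply, Fin.sum_univ_four] <;> field_simp <;> ring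

/-- `√(-g) □f` in divergence form. -/
lemma IsBlackHole.volDensity_mul_box {m : HTMetric} {rH ΩH : ℝ} (hm : IsBlackHole m rH ΩH)
    {f : ℝ → ℝ → ℝ} (hf : ∀ p : ℝ × ℝ, rH < p.1 →
      DifferentiableAt ℝ (fun p : ℝ × ℝ => f p.1 p.2) p)
    {x : Fin 4 → ℝ} (hx : x ∈ exterior rH)
    (h1 : DifferentiableAt ℝ (m.radialFlux fun p => f p.1 p.2) (x 1, x 2))
    (h2 : DifferentiableAt ℝ (m.angularFlux fun p => f p.1 p.2) (x 1, x 2)) :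
    volDensity m.g x * box m.g (lift f) x
      = dR (m.radialFlux fun p => f p.1 p.2) (x 1, x 2)
        + dTheta (m.angularFlux fun p => f p.1 p.2) (x 1, x 2) := by
  have hvol : ∀ y ∈ exterior rH, volDensity m.g y
      = m.N (y 1) (y 2) * m.A (y 1) (y 2) * y 1 ^ 2 * m.B (y 1) (y 2) ^ 2
          * Real.sin (y 2) := fun y hy => by
    rw [hm.volDensity_eq hy.1, abs_of_pos (Real.sin_pos_of_pos_of_lt_pi hy.2.1 hy.2.2)]
  have key : ∀ y ∈ exterior rH, ∀ i,
      volDensity m.g y * ∑ j, (m.g y)⁻¹ i j * pd j (lift f) y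
        = (![0, m.radialFlux (fun p => f p.1 p.2) (y 1, y 2),
            m.angularFlux (fun p => f p.1 p.2) (y 1, y 2), 0] : Fin 4 → ℝ) i := by
    intro y hy i
    obtain ⟨e0, e1, e2, e3⟩ := pd_comp_polar (hf (y 1, y 2) hy.1)
    obtain ⟨hN, hA, hB⟩ := hm.pos (y 1) (y 2) hy.1
    have hr0 := (hm.radius_pos hy.1).ne'
    have hs := (Real.sin_pos_of_pos_of_lt_pi hy.2.1 hy.2.2).ne'
    have hN' := hN.ne'
    have hA' := hA.ne'
    have hB' := hB.ne'
    change volDensity m.g y * ∑ j, (m.g y)⁻¹ i j * pd j (fun z => f (z 1) (z 2)) y = _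
    rw [Fin.sum_univ_four, e0, e1, e2, e3, hvol y hy, hm.inv_g hy]
    fin_cases i <;>
      simp [HTMetric.radialFlux, HTMetric.angularFlux, HTMetric.radialCoeff,
        HTMetric.angularCoeff] <;> field_simp
  -- The exterior is open, so the pointwise formula for the flux may be differentiated.
  have hpd : ∀ i, pd i (fun y => volDensity m.g y * ∑ j, (m.g y)⁻¹ i j * pd j (lift f) y) x
      = pd i (fun y => (![0, m.radialFlux (fun p => f p.1 p.2) (y 1, y 2),
            m.angularFlux (fun p => f p.1 p.2) (y 1, y 2), 0] : Fin 4 → ℝ) i) x := by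
    intro i
    unfold pd
    rw [Filter.EventuallyEq.fderiv_eq]
    filter_upwards [(isOpen_exterior rH).mem_nhds hx] with y hy using key y hy i
  have hv : volDensity m.g x ≠ 0 := by
    rw [hvol x hx]
    obtain ⟨hN, hA, hB⟩ := hm.pos (x 1) (x 2) hx.1
    have hr0 := hm.radius_pos hx.1
    have hs := Real.sin_pos_of_pos_of_lt_pi hx.2.1 hx.2.2
    positivity
  unfold box
  simp only [hpd]
  rw [← mul_assoc, mul_one_div_cancel hv, one_mul, Fin.sum_univ_four]
  have z : ∀ i, pd i (fun _ => (0 : ℝ)) x = 0 := fun i => by simp [pd]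
  simp [z, (pd_comp_polar h1).2.1, (pd_comp_polar h2).2.2.1]

/-! ## Regularity up to the horizon -/

lemma ContDiffAt.dR {H : ℝ × ℝ → ℝ} {p : ℝ × ℝ} (hH : ContDiffAt ℝ ∞ H p) :
    ContDiffAt ℝ ∞ (dR H) p :=
  (hH.fderiv_right (m := ∞) le_rfl).clm_apply contDiffAt_const

lemma ContDiffAt.dTheta {H : ℝ × ℝ → ℝ} {p : ℝ × ℝ} (hH : ContDiffAt ℝ ∞ H p) :
    ContDiffAt ℝ ∞ (dTheta H) p :=
  (hH.fderiv_right (m := ∞) le_rfl).clm_apply contDiffAt_const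

lemma differentiableAt_of_smooth {H : ℝ × ℝ → ℝ} {p : ℝ × ℝ} (hH : ContDiffAt ℝ ∞ H p) :
    DifferentiableAt ℝ H p := hH.differentiableAt (by simp)

lemma contDiffAt_sin_snd (p : ℝ × ℝ) : ContDiffAt ℝ ∞ (fun p : ℝ × ℝ => Real.sin p.2) p :=
  (Real.contDiff_sin.comp contDiff_snd).contDiffAt

lemma dR_congr {H K : ℝ × ℝ → ℝ} {p : ℝ × ℝ} (h : H =ᶠ[𝓝 p] K) : dR H p = dR K p := by
  unfold dR; rw [h.fderiv_eq]

lemma dTheta_congr {H K : ℝ × ℝ → ℝ} {p : ℝ × ℝ} (h : H =ᶠ[𝓝 p] K) :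
    dTheta H p = dTheta K p := by
  unfold dTheta; rw [h.fderiv_eq]

lemma dR_mul {H K : ℝ × ℝ → ℝ} {p : ℝ × ℝ} (hH : DifferentiableAt ℝ H p)
    (hK : DifferentiableAt ℝ K p) :
    dR (fun q => H q * K q) p = H p * dR K p + K p * dR H p := by
  unfold dR; rw [fderiv_fun_mul hH hK]; simp

lemma dTheta_mul {H K : ℝ × ℝ → ℝ} {p : ℝ × ℝ} (hH : DifferentiableAt ℝ H p)
    (hK : DifferentiableAt ℝ K p) :
    dTheta (fun q => H q * K q) p = H p * dTheta K p + K p * dTheta H p := by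
  unfold dTheta; rw [fderiv_fun_mul hH hK]; simp

lemma dR_sub {H K : ℝ × ℝ → ℝ} {p : ℝ × ℝ} (hH : DifferentiableAt ℝ H p)
    (hK : DifferentiableAt ℝ K p) : dR (fun q => H q - K q) p = dR H p - dR K p := by
  unfold dR; rw [fderiv_fun_sub hH hK]; simp

lemma dTheta_sub {H K : ℝ × ℝ → ℝ} {p : ℝ × ℝ} (hH : DifferentiableAt ℝ H p)
    (hK : DifferentiableAt ℝ K p) :
    dTheta (fun q => H q - K q) p = dTheta H p - dTheta K p := by
  unfold dTheta; rw [fderiv_fun_sub hH hK]; simp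

lemma eventually_fst_gt {rH : ℝ} {p : ℝ × ℝ} (hp : rH < p.1) : ∀ᶠ q : ℝ × ℝ in 𝓝 p, rH < q.1 :=
  continuousAt_fst.eventually (lt_mem_nhds hp)

lemma ExtendsSmoothly.contDiffAt {rH : ℝ} {f : ℝ → ℝ → ℝ} {b : ℝ → ℝ}
    (h : ExtendsSmoothly rH f b) {p : ℝ × ℝ} (hp : rH < p.1) :
    ContDiffAt ℝ ∞ (fun p : ℝ × ℝ => f p.1 p.2) p := by
  obtain ⟨F, hF, hFf, -⟩ := h
  exact hF.contDiffAt.congr_of_eventuallyEq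
    ((eventually_fst_gt hp).mono fun q hq => (hFf q.1 q.2 hq).symm)

lemma IsBlackHole.contDiffAt_N {m : HTMetric} {rH ΩH : ℝ} (hm : IsBlackHole m rH ΩH)
    {p : ℝ × ℝ} (hp : rH < p.1) : ContDiffAt ℝ ∞ (fun p : ℝ × ℝ => m.N p.1 p.2) p := by
  have h := hm.horizon_N.contDiffAt hp
  have hN := (hm.pos p.1 p.2 hp).1
  refine (h.sqrt (by positivity)).congr_of_eventuallyEq
    ((eventually_fst_gt hp).mono fun q hq => ?_)
  exact (Real.sqrt_sq (hm.pos q.1 q.2 hq).1.le).symm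

lemma IsBlackHole.contDiffAt_B {m : HTMetric} {rH ΩH : ℝ} (hm : IsBlackHole m rH ΩH)
    {p : ℝ × ℝ} (hp : rH < p.1) : ContDiffAt ℝ ∞ (fun p : ℝ × ℝ => m.B p.1 p.2) p :=
  let ⟨_, h, _⟩ := hm.horizon_B
  h.contDiffAt hp

lemma IsBlackHole.contDiffAt_A {m : HTMetric} {rH ΩH : ℝ} (hm : IsBlackHole m rH ΩH)
    {p : ℝ × ℝ} (hp : rH < p.1) : ContDiffAt ℝ ∞ (fun p : ℝ × ℝ => m.A p.1 p.2) p := by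
  obtain ⟨b, h, -⟩ := hm.horizon_NA
  refine ((h.contDiffAt hp).div (hm.contDiffAt_N hp) (hm.pos _ _ hp).1.ne').congr_of_eventuallyEq
    ((eventually_fst_gt hp).mono fun q hq => ?_)
  have := (hm.pos q.1 q.2 hq).1.ne'
  simp only [Pi.div_apply]
  field_simp

lemma RegularScalar.contDiffAt {rH : ℝ} {f : ℝ → ℝ → ℝ} (hf : RegularScalar rH f) {p : ℝ × ℝ}
    (hp : rH < p.1) : ContDiffAt ℝ ∞ (fun p : ℝ × ℝ => f p.1 p.2) p :=
  let ⟨_, h⟩ := hf.1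
  h.contDiffAt hp

/-- `N` and `A` are not assumed smooth at the horizon, but `N r² B² / A = N² r² B² / (N A)` involves
only quantities that are, with a nonzero denominator. The factor `N²` makes it vanish there. -/
lemma IsBlackHole.exists_radialCoeff_extension {m : HTMetric} {rH ΩH : ℝ}
    (hm : IsBlackHole m rH ΩH) :
    ∃ P : ℝ × ℝ → ℝ, (∀ p : ℝ × ℝ, rH ≤ p.1 → ContDiffAt ℝ ∞ P p) ∧
      (∀ p : ℝ × ℝ, rH < p.1 → P p = m.radialCoeff p) ∧ ∀ θ, P (rH, θ) = 0 := by
  obtain ⟨F, hF, hF1, hF2⟩ := hm.horizon_N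
  obtain ⟨b, ⟨K, hK, hK1, hK2⟩, hb⟩ := hm.horizon_NA
  obtain ⟨c, ⟨L, hL, hL1, -⟩, -⟩ := hm.horizon_B
  refine ⟨fun p => F p * p.1 ^ 2 * L p ^ 2 / K p, fun p hp => ?_, fun p hp => ?_, fun θ => ?_⟩
  · have hK0 : K p ≠ 0 := by
      rcases hp.lt_or_eq with h | h
      · obtain ⟨hN, hA, -⟩ := hm.pos p.1 p.2 h
        rw [← Prod.mk.eta (p := p), hK1 _ _ h]; positivity
      · rw [← Prod.mk.eta (p := p), ← h, hK2]; exact (hb _).ne'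
    exact ((hF.mul (contDiff_fst.pow 2)).mul (hL.pow 2)).contDiffAt.div hK.contDiffAt hK0
  · obtain ⟨hN, hA, -⟩ := hm.pos p.1 p.2 hp
    have e1 := hF1 p.1 p.2 hp
    have e2 := hK1 p.1 p.2 hp
    have e3 := hL1 p.1 p.2 hp
    simp only [Prod.mk.eta] at e1 e2 e3
    simp only [e1, e2, e3, HTMetric.radialCoeff]
    field_simp
  · simp [hF2]

lemma IsBlackHole.exists_angularCoeff_extension {m : HTMetric} {rH ΩH : ℝ}
    (hm : IsBlackHole m rH ΩH) :
    ∃ Q : ℝ × ℝ → ℝ, (∀ p : ℝ × ℝ, ContDiffAt ℝ ∞ Q p) ∧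
      ∀ p : ℝ × ℝ, rH < p.1 → Q p = m.angularCoeff p := by
  obtain ⟨b, ⟨K, hK, hK1, -⟩, -⟩ := hm.horizon_NA
  exact ⟨K, fun p => hK.contDiffAt, fun p hp => hK1 p.1 p.2 hp⟩

lemma IsBlackHole.contDiffAt_radialCoeff {m : HTMetric} {rH ΩH : ℝ} (hm : IsBlackHole m rH ΩH)
    {p : ℝ × ℝ} (hp : rH < p.1) : ContDiffAt ℝ ∞ m.radialCoeff p := by
  obtain ⟨P, hP, hP1, -⟩ := hm.exists_radialCoeff_extension
  exact (hP p hp.le).congr_of_eventuallyEq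
    ((eventually_fst_gt hp).mono fun q hq => (hP1 q hq).symm)

lemma IsBlackHole.contDiffAt_angularCoeff {m : HTMetric} {rH ΩH : ℝ} (hm : IsBlackHole m rH ΩH)
    {p : ℝ × ℝ} (hp : rH < p.1) : ContDiffAt ℝ ∞ m.angularCoeff p := by
  obtain ⟨Q, hQ, hQ1⟩ := hm.exists_angularCoeff_extension
  exact (hQ p).congr_of_eventuallyEq
    ((eventually_fst_gt hp).mono fun q hq => (hQ1 q hq).symm)

/-- `√(-g) □f` in divergence form, for a regular scalar. -/
lemma IsBlackHole.volDensity_mul_box_of_regular {m : HTMetric} {rH ΩH : ℝ}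
    (hm : IsBlackHole m rH ΩH) {f : ℝ → ℝ → ℝ} (hf : RegularScalar rH f)
    {x : Fin 4 → ℝ} (hx : x ∈ exterior rH) :
    volDensity m.g x * box m.g (lift f) x
      = dR (m.radialFlux fun p => f p.1 p.2) (x 1, x 2)
        + dTheta (m.angularFlux fun p => f p.1 p.2) (x 1, x 2) := by
  have hfx := hf.contDiffAt (p := (x 1, x 2)) hx.1
  refine hm.volDensity_mul_box (fun p hp => differentiableAt_of_smooth (hf.contDiffAt hp)) hx ?_ ?_
  · exact differentiableAt_of_smooth (((hm.contDiffAt_radialCoeff (p := (x 1, x 2)) hx.1).mul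
      (contDiffAt_sin_snd _)).mul (ContDiffAt.dR hfx))
  · exact differentiableAt_of_smooth (((hm.contDiffAt_angularCoeff (p := (x 1, x 2)) hx.1).mul
      (contDiffAt_sin_snd _)).mul (ContDiffAt.dTheta hfx))

/-! ## Green's identity -/

/-- Green's identity for a divergence-form operator on `[a, R] × [0, π]` whose coefficients
vanish at `r = a` and at the axis. -/
lemma green_identity {a R : ℝ} (haR : a < R) {P Q U V : ℝ × ℝ → ℝ}
    (hP : ∀ p : ℝ × ℝ, a ≤ p.1 → ContDiffAt ℝ ∞ P p)
    (hQ : ∀ p : ℝ × ℝ, a ≤ p.1 → ContDiffAt ℝ ∞ Q p)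
    (hU : ∀ p : ℝ × ℝ, a ≤ p.1 → ContDiffAt ℝ ∞ U p)
    (hV : ∀ p : ℝ × ℝ, a ≤ p.1 → ContDiffAt ℝ ∞ V p) (hPa : ∀ θ, P (a, θ) = 0) :
    ∫ r in a..R, ∫ θ in (0 : ℝ)..Real.pi,
      (V (r, θ) * (dR (fun p => P p * Real.sin p.2 * dR U p) (r, θ)
          + dTheta (fun p => Q p * Real.sin p.2 * dTheta U p) (r, θ))
        - U (r, θ) * (dR (fun p => P p * Real.sin p.2 * dR V p) (r, θ)
          + dTheta (fun p => Q p * Real.sin p.2 * dTheta V p) (r, θ)))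
    = ∫ θ in (0 : ℝ)..Real.pi,
        P (R, θ) * Real.sin θ * (V (R, θ) * dR U (R, θ) - U (R, θ) * dR V (R, θ)) := by
  have s1 : ∀ W : ℝ × ℝ → ℝ, (∀ p : ℝ × ℝ, a ≤ p.1 → ContDiffAt ℝ ∞ W p) →
      ∀ p : ℝ × ℝ, a ≤ p.1 → ContDiffAt ℝ ∞ (fun p => P p * Real.sin p.2 * dR W p) p :=
    fun W hW p hp => ((hP p hp).mul (contDiffAt_sin_snd _)).mul (ContDiffAt.dR (hW p hp))
  have s2 : ∀ W : ℝ × ℝ → ℝ, (∀ p : ℝ × ℝ, a ≤ p.1 → ContDiffAt ℝ ∞ W p) →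
      ∀ p : ℝ × ℝ, a ≤ p.1 → ContDiffAt ℝ ∞ (fun p => Q p * Real.sin p.2 * dTheta W p) p :=
    fun W hW p hp => ((hQ p hp).mul (contDiffAt_sin_snd _)).mul (ContDiffAt.dTheta (hW p hp))
  -- The current `V ∇U - U ∇V`; in its divergence the terms `∇U · ∇V` cancel.
  set f : ℝ × ℝ → ℝ := fun p => V p * (P p * Real.sin p.2 * dR U p)
    - U p * (P p * Real.sin p.2 * dR V p) with hf
  set g : ℝ × ℝ → ℝ := fun p => V p * (Q p * Real.sin p.2 * dTheta U p)
    - U p * (Q p * Real.sin p.2 * dTheta V p) with hg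
  have cf : ∀ p : ℝ × ℝ, a ≤ p.1 → ContDiffAt ℝ ∞ f p := fun p hp =>
    ((hV p hp).mul (s1 U hU p hp)).sub ((hU p hp).mul (s1 V hV p hp))
  have cg : ∀ p : ℝ × ℝ, a ≤ p.1 → ContDiffAt ℝ ∞ g p := fun p hp =>
    ((hV p hp).mul (s2 U hU p hp)).sub ((hU p hp).mul (s2 V hV p hp))
  have hdiv : ∀ p : ℝ × ℝ, a ≤ p.1 → dR f p + dTheta g p
      = V p * (dR (fun p => P p * Real.sin p.2 * dR U p) p
          + dTheta (fun p => Q p * Real.sin p.2 * dTheta U p) p)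
        - U p * (dR (fun p => P p * Real.sin p.2 * dR V p) p
          + dTheta (fun p => Q p * Real.sin p.2 * dTheta V p) p) := by
    intro p hp
    have dU := differentiableAt_of_smooth (hU p hp)
    have dV := differentiableAt_of_smooth (hV p hp)
    have a1 := differentiableAt_of_smooth (s1 U hU p hp)
    have a2 := differentiableAt_of_smooth (s1 V hV p hp)
    have b1 := differentiableAt_of_smooth (s2 U hU p hp)
    have b2 := differentiableAt_of_smooth (s2 V hV p hp)
    have e1 : dR f p = dR (fun p => V p * (P p * Real.sin p.2 * dR U p)) p
        - dR (fun p => U p * (P p * Real.sin p.2 * dR V p)) p := by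
      exact dR_sub (dV.mul a1) (dU.mul a2)
    have e2 : dTheta g p = dTheta (fun p => V p * (Q p * Real.sin p.2 * dTheta U p)) p
        - dTheta (fun p => U p * (Q p * Real.sin p.2 * dTheta V p)) p := by
      exact dTheta_sub (dV.mul b1) (dU.mul b2)
    rw [e1, e2, dR_mul dV a1, dR_mul dU a2, dTheta_mul dV b1, dTheta_mul dU b2]
    ring
  have hle : ∀ p ∈ Set.uIcc a R ×ˢ Set.uIcc 0 Real.pi, a ≤ p.1 := fun p hp => by
    have := hp.1; rw [Set.uIcc_of_le haR.le] at this; exact this.1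
  have hlt : ∀ p ∈ Set.Ioo (min a R) (max a R) ×ˢ Set.Ioo (min 0 Real.pi) (max 0 Real.pi),
      a ≤ p.1 := fun p hp => by
    have := hp.1.1; rw [min_eq_left haR.le] at this; exact this.le
  have hcont : ContinuousOn (fun p => dR f p + dTheta g p)
      (Set.uIcc a R ×ˢ Set.uIcc 0 Real.pi) := fun p hp =>
    ((ContDiffAt.dR (cf p (hle p hp))).continuousAt.add
      (ContDiffAt.dTheta (cg p (hle p hp))).continuousAt).continuousWithinAt
  have main := MeasureTheory.integral2_divergence_prod_of_hasFDerivAt_off_countable f g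
    (fderiv ℝ f) (fderiv ℝ g) a 0 R Real.pi ∅ Set.countable_empty
    (fun p hp => (cf p (hle p hp)).continuousAt.continuousWithinAt)
    (fun p hp => (cg p (hle p hp)).continuousAt.continuousWithinAt)
    (fun p hp => (differentiableAt_of_smooth (cf p (hlt p hp.1))).hasFDerivAt)
    (fun p hp => (differentiableAt_of_smooth (cg p (hlt p hp.1))).hasFDerivAt)
    (hcont.integrableOn_compact (isCompact_uIcc.prod isCompact_uIcc))
  -- Three of the four sides drop out: the two axis segments through `sin θ`, the horizon through
  -- `P`.
  have z1 : ∀ r, g (r, Real.pi) = 0 := fun r => by simp [hg]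
  have z2 : ∀ r, g (r, 0) = 0 := fun r => by simp [hg]
  have z3 : ∀ θ, f (a, θ) = 0 := fun θ => by simp [hf, hPa]
  simp only [z1, z2, z3, intervalIntegral.integral_zero, sub_zero, zero_add] at main
  have lhs : ∫ r in a..R, ∫ θ in (0 : ℝ)..Real.pi,
      (V (r, θ) * (dR (fun p => P p * Real.sin p.2 * dR U p) (r, θ)
          + dTheta (fun p => Q p * Real.sin p.2 * dTheta U p) (r, θ))
        - U (r, θ) * (dR (fun p => P p * Real.sin p.2 * dR V p) (r, θ)
          + dTheta (fun p => Q p * Real.sin p.2 * dTheta V p) (r, θ)))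
      = ∫ r in a..R, ∫ θ in (0 : ℝ)..Real.pi,
          ((fderiv ℝ f (r, θ)) (1, 0) + (fderiv ℝ g (r, θ)) (0, 1)) := by
    refine intervalIntegral.integral_congr fun r hr => ?_
    rw [Set.uIcc_of_le haR.le] at hr
    exact intervalIntegral.integral_congr fun θ _ => (hdiv (r, θ) hr.1).symm
  rw [lhs, main]
  refine intervalIntegral.integral_congr fun θ _ => ?_
  simp only [hf]
  ring

/-- Green's identity between a solution of the sourced equation and a homogeneous solution:
the source density `G = ε √(-g) *RR v` extends continuously to the horizon, and its integrals
are fluxes through spheres. -/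
lemma IsBlackHole.exists_source_density {m : HTMetric} {rH ΩH ε : ℝ} (hm : IsBlackHole m rH ΩH)
    {Φ v : ℝ → ℝ → ℝ} (hΦ : RegularScalar rH Φ) (heq : SolvesDCS m rH ε Φ)
    (hv : RegularScalar rH v) (hv0 : ∀ x ∈ exterior rH, box m.g (lift v) x = 0) :
    ∃ G : ℝ × ℝ → ℝ, ContinuousOn G (Set.Ici rH ×ˢ Set.univ) ∧
      (∀ x ∈ exterior rH, G (x 1, x 2)
        = ε * (pontryagin m.g x * lift v x) * volDensity m.g x) ∧
      ∀ R, rH < R → ∫ r in rH..R, ∫ θ in (0 : ℝ)..Real.pi, G (r, θ)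
        = -∫ θ in (0 : ℝ)..Real.pi, m.radialCoeff (R, θ) * Real.sin θ *
            (v R θ * dR (fun p => Φ p.1 p.2) (R, θ) - Φ R θ * dR (fun p => v p.1 p.2) (R, θ)) := by
  obtain ⟨P, hP, hP1, hP2⟩ := hm.exists_radialCoeff_extension
  obtain ⟨Q, hQ, hQ1⟩ := hm.exists_angularCoeff_extension
  obtain ⟨bU, U, hU, hU1, -⟩ := hΦ.1
  obtain ⟨bV, V, hV, hV1, -⟩ := hv.1
  have near : ∀ {W : ℝ × ℝ → ℝ} {w : ℝ → ℝ → ℝ}, (∀ r θ, rH < r → W (r, θ) = w r θ) →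
      ∀ {p : ℝ × ℝ}, rH < p.1 → W =ᶠ[𝓝 p] fun p => w p.1 p.2 := fun h p hp =>
    (eventually_fst_gt hp).mono fun q hq => h q.1 q.2 hq
  have hbox : ∀ {W : ℝ × ℝ → ℝ} {w : ℝ → ℝ → ℝ}, (∀ r θ, rH < r → W (r, θ) = w r θ) →
      RegularScalar rH w → ∀ x ∈ exterior rH,
      dR (fun p => P p * Real.sin p.2 * dR W p) (x 1, x 2)
        + dTheta (fun p => Q p * Real.sin p.2 * dTheta W p) (x 1, x 2)
      = volDensity m.g x * box m.g (lift w) x := by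
    intro W w hW hw x hx
    rw [hm.volDensity_mul_box_of_regular hw hx]
    congr 1
    · refine dR_congr ((eventually_fst_gt (p := (x 1, x 2)) hx.1).mono fun q hq => ?_)
      simp only [HTMetric.radialFlux, hP1 q hq, dR_congr (near hW hq)]
    · refine dTheta_congr ((eventually_fst_gt (p := (x 1, x 2)) hx.1).mono fun q hq => ?_)
      simp only [HTMetric.angularFlux, hQ1 q hq, dTheta_congr (near hW hq)]
  have s1 : ∀ W : ℝ × ℝ → ℝ, ContDiff ℝ ∞ W → ∀ p : ℝ × ℝ, rH ≤ p.1 →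
      ContinuousAt (dR fun p => P p * Real.sin p.2 * dR W p) p := fun W hW p hp =>
    (ContDiffAt.dR (((hP p hp).mul (contDiffAt_sin_snd _)).mul
      (ContDiffAt.dR hW.contDiffAt))).continuousAt
  have s2 : ∀ W : ℝ × ℝ → ℝ, ContDiff ℝ ∞ W → ∀ p : ℝ × ℝ,
      ContinuousAt (dTheta fun p => Q p * Real.sin p.2 * dTheta W p) p := fun W hW p =>
    (ContDiffAt.dTheta (((hQ p).mul (contDiffAt_sin_snd _)).mul
      (ContDiffAt.dTheta hW.contDiffAt))).continuousAt
  -- Minus the divergence of the Green current, built from the smooth extensions so that it makes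
  -- sense at the horizon. The sign comes from `□Φ = -ε *RR`.
  refine ⟨fun p => -(V p * (dR (fun p => P p * Real.sin p.2 * dR U p) p
          + dTheta (fun p => Q p * Real.sin p.2 * dTheta U p) p)
        - U p * (dR (fun p => P p * Real.sin p.2 * dR V p) p
          + dTheta (fun p => Q p * Real.sin p.2 * dTheta V p) p)), ?_, ?_, ?_⟩
  · intro p hp
    have hp' : rH ≤ p.1 := hp.1
    exact (((hV.continuous.continuousAt.mul ((s1 U hU p hp').add (s2 U hU p))).sub
      (hU.continuous.continuousAt.mul ((s1 V hV p hp').add (s2 V hV p)))).neg).continuousWithinAt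
  · intro x hx
    have h1 := heq x hx
    simp only [hbox hU1 hΦ x hx, hbox hV1 hv x hx, hv0 x hx, hV1 _ _ hx.1, lift] at *
    linear_combination (-v (x 1) (x 2) * volDensity m.g x) * h1
  · intro R hR
    simp only [intervalIntegral.integral_neg]
    rw [green_identity hR hP (fun p _ => hQ p) (fun p _ => hU.contDiffAt)
      (fun p _ => hV.contDiffAt) hP2]
    congr 1
    refine intervalIntegral.integral_congr fun θ _ => ?_
    have hR' : rH < (R, θ).1 := hR
    simp only [hP1 (R, θ) hR', hU1 R θ hR, hV1 R θ hR, dR_congr (near hU1 hR'),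
      dR_congr (near hV1 hR')]

/-! ## Asymptotics as `r → ∞`, uniformly in `θ` -/

/-- The filter of `r → ∞`, uniformly in `θ`. -/
def radialInfinity : Filter (ℝ × ℝ) := atTop ×ˢ ⊤

lemma eventually_radialInfinity_gt (a : ℝ) : ∀ᶠ p in radialInfinity, a < p.1 :=
  (eventually_gt_atTop a).prod_inl _

lemma tendsto_fst_radialInfinity : Tendsto Prod.fst radialInfinity atTop := tendsto_fst

lemma tendsto_const_div_radialInfinity (c : ℝ) :
    Tendsto (fun p : ℝ × ℝ => c / p.1) radialInfinity (𝓝 0) :=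
  tendsto_fst_radialInfinity.const_div_atTop c

lemma tendsto_ray (θ : ℝ) : Tendsto (fun r : ℝ => (r, θ)) atTop radialInfinity :=
  tendsto_id.prodMk (tendsto_top)

lemma IsRemainder.tendsto {k : ℕ} {E : ℝ → ℝ → ℝ} (hE : IsRemainder k E) {i j n : ℕ}
    (hij : i + j ≤ 2) (hn : n < k + i) :
    Tendsto (fun p : ℝ × ℝ =>
      p.1 ^ n * iteratedDeriv i (fun s => iteratedDeriv j (E s) p.2) p.1)
      radialInfinity (𝓝 0) := by
  obtain ⟨C, R, hR, hC⟩ := hE i j hij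
  refine squeeze_zero_norm' ?_ (tendsto_const_div_radialInfinity |C|)
  filter_upwards [eventually_radialInfinity_gt R, eventually_radialInfinity_gt 1] with p hp hp1
  have h0 : 0 < p.1 := by linarith
  rw [Real.norm_eq_abs, abs_mul, abs_of_pos (pow_pos h0 n)]
  calc p.1 ^ n * _ ≤ p.1 ^ n * (|C| / p.1 ^ (k + i)) :=
        mul_le_mul_of_nonneg_left ((hC p.1 p.2 hp).trans (by gcongr; exact le_abs_self C))
          (by positivity)
    _ = |C| * p.1 ^ n / p.1 ^ (k + i) := by ring
    _ ≤ |C| / p.1 := by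
        rw [div_le_div_iff₀ (by positivity) h0, mul_assoc, ← pow_succ]
        exact mul_le_mul_of_nonneg_left (pow_le_pow_right₀ hp1.le hn) (abs_nonneg C)

lemma hasDerivAt_dR {H : ℝ × ℝ → ℝ} {r θ : ℝ} (hH : ContDiffAt ℝ ∞ H (r, θ)) :
    HasDerivAt (fun s => H (s, θ)) (dR H (r, θ)) r :=
  (differentiableAt_of_smooth hH).hasFDerivAt.comp_hasDerivAt r
    ((hasDerivAt_id r).prodMk (hasDerivAt_const r θ))

lemma hasDerivAt_dTheta {H : ℝ × ℝ → ℝ} {r θ : ℝ} (hH : ContDiffAt ℝ ∞ H (r, θ)) :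
    HasDerivAt (fun s => H (r, s)) (dTheta H (r, θ)) θ :=
  (differentiableAt_of_smooth hH).hasFDerivAt.comp_hasDerivAt θ
    ((hasDerivAt_const θ r).prodMk (hasDerivAt_id θ))

/-! ### Limits of the derivatives of a function with a known expansion. -/

section Expansion

variable {rH : ℝ} {k : ℕ} {f e : ℝ → ℝ → ℝ}

lemma IsRemainder.tendsto_sub (hE : IsRemainder k (fun r θ => f r θ - e r θ)) {n : ℕ}
    (hn : n < k) :
    Tendsto (fun p : ℝ × ℝ => p.1 ^ n * (f p.1 p.2 - e p.1 p.2)) radialInfinity (𝓝 0) := by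
  simpa using hE.tendsto (i := 0) (j := 0) (by norm_num) hn

lemma IsRemainder.tendsto_dR (hE : IsRemainder k (fun r θ => f r θ - e r θ))
    (hf : ∀ p : ℝ × ℝ, rH < p.1 → ContDiffAt ℝ ∞ (fun p : ℝ × ℝ => f p.1 p.2) p)
    {e' : ℝ → ℝ → ℝ} (he : ∀ r θ, rH < r → HasDerivAt (fun s => e s θ) (e' r θ) r)
    {n : ℕ} (hn : n < k + 1) :
    Tendsto (fun p : ℝ × ℝ => p.1 ^ n * (dR (fun p => f p.1 p.2) p - e' p.1 p.2))
      radialInfinity (𝓝 0) := by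
  refine (hE.tendsto (i := 1) (j := 0) (by norm_num) hn).congr' ?_
  filter_upwards [eventually_radialInfinity_gt rH] with p hp
  simp only [iteratedDeriv_zero, iteratedDeriv_one]
  exact congrArg (p.1 ^ n * ·) ((hasDerivAt_dR (hf p hp)).sub (he p.1 p.2 hp)).deriv

lemma IsRemainder.tendsto_dR_dR (hE : IsRemainder k (fun r θ => f r θ - e r θ))
    (hf : ∀ p : ℝ × ℝ, rH < p.1 → ContDiffAt ℝ ∞ (fun p : ℝ × ℝ => f p.1 p.2) p)
    {e' e'' : ℝ → ℝ → ℝ} (he : ∀ r θ, rH < r → HasDerivAt (fun s => e s θ) (e' r θ) r)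
    (he' : ∀ r θ, rH < r → HasDerivAt (fun s => e' s θ) (e'' r θ) r)
    {n : ℕ} (hn : n < k + 2) :
    Tendsto (fun p : ℝ × ℝ => p.1 ^ n * (dR (dR fun p => f p.1 p.2) p - e'' p.1 p.2))
      radialInfinity (𝓝 0) := by
  refine (hE.tendsto (i := 2) (j := 0) (by norm_num) hn).congr' ?_
  filter_upwards [eventually_radialInfinity_gt rH] with p hp
  simp only [iteratedDeriv_zero, iteratedDeriv_succ]
  -- A second derivative needs the first one on a neighbourhood, not just at the point.
  have h : deriv (fun s => f s p.2 - e s p.2) =ᶠ[𝓝 p.1]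
      fun s => dR (fun p => f p.1 p.2) (s, p.2) - e' s p.2 :=
    (lt_mem_nhds hp).mono fun s hs =>
      ((hasDerivAt_dR (H := fun p => f p.1 p.2) (hf (s, p.2) hs)).sub (he s p.2 hs)).deriv
  rw [h.deriv_eq]
  exact congrArg (p.1 ^ n * ·)
    ((hasDerivAt_dR (ContDiffAt.dR (hf p hp))).sub (he' p.1 p.2 hp)).deriv

lemma IsRemainder.tendsto_dTheta (hE : IsRemainder k (fun r θ => f r θ - e r θ))
    (hf : ∀ p : ℝ × ℝ, rH < p.1 → ContDiffAt ℝ ∞ (fun p : ℝ × ℝ => f p.1 p.2) p)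
    {e' : ℝ → ℝ → ℝ} (he : ∀ r θ, rH < r → HasDerivAt (e r) (e' r θ) θ)
    {n : ℕ} (hn : n < k) :
    Tendsto (fun p : ℝ × ℝ => p.1 ^ n * (dTheta (fun p => f p.1 p.2) p - e' p.1 p.2))
      radialInfinity (𝓝 0) := by
  refine (hE.tendsto (i := 0) (j := 1) (by norm_num) hn).congr' ?_
  filter_upwards [eventually_radialInfinity_gt rH] with p hp
  simp only [iteratedDeriv_zero, iteratedDeriv_one]
  exact congrArg (p.1 ^ n * ·) ((hasDerivAt_dTheta (hf p hp)).sub (he p.1 p.2 hp)).deriv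

lemma IsRemainder.tendsto_dTheta_dTheta (hE : IsRemainder k (fun r θ => f r θ - e r θ))
    (hf : ∀ p : ℝ × ℝ, rH < p.1 → ContDiffAt ℝ ∞ (fun p : ℝ × ℝ => f p.1 p.2) p)
    {e' e'' : ℝ → ℝ → ℝ} (he : ∀ r θ, rH < r → HasDerivAt (e r) (e' r θ) θ)
    (he' : ∀ r θ, rH < r → HasDerivAt (e' r) (e'' r θ) θ)
    {n : ℕ} (hn : n < k) :
    Tendsto (fun p : ℝ × ℝ => p.1 ^ n * (dTheta (dTheta fun p => f p.1 p.2) p - e'' p.1 p.2))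
      radialInfinity (𝓝 0) := by
  refine (hE.tendsto (i := 0) (j := 2) (by norm_num) hn).congr' ?_
  filter_upwards [eventually_radialInfinity_gt rH] with p hp
  simp only [iteratedDeriv_zero, iteratedDeriv_succ]
  have h : deriv (fun θ => f p.1 θ - e p.1 θ) =
      fun θ => dTheta (fun p => f p.1 p.2) (p.1, θ) - e' p.1 θ :=
    funext fun θ =>
      ((hasDerivAt_dTheta (H := fun p => f p.1 p.2) (hf (p.1, θ) hp)).sub (he p.1 θ hp)).deriv
  rw [h]
  exact congrArg (p.1 ^ n * ·)
    ((hasDerivAt_dTheta (ContDiffAt.dTheta (hf p hp))).sub (he' p.1 p.2 hp)).deriv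

end Expansion

/-- `H` is smooth for `r > rH` and `H → 1`, `r ∂_r H → 0`, `∂_θ H → 0` as `r → ∞`. -/
structure TendsToOne (rH : ℝ) (H : ℝ × ℝ → ℝ) : Prop where
  smooth : ∀ p : ℝ × ℝ, rH < p.1 → ContDiffAt ℝ ∞ H p
  tendsto : Tendsto H radialInfinity (𝓝 1)
  radial : Tendsto (fun p => p.1 * dR H p) radialInfinity (𝓝 0)
  angular : Tendsto (dTheta H) radialInfinity (𝓝 0)

/-- Closure under products and inverses passes the limits from `N`, `A`, `B` to the coefficients of
the wave operator, of which only the leading behaviour is needed. -/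
lemma TendsToOne.mul {rH : ℝ} {H K : ℝ × ℝ → ℝ} (hH : TendsToOne rH H) (hK : TendsToOne rH K) :
    TendsToOne rH (fun p => H p * K p) where
  smooth p hp := (hH.smooth p hp).mul (hK.smooth p hp)
  tendsto := by simpa using hH.tendsto.mul hK.tendsto
  radial := by
    have h := (hH.tendsto.mul hK.radial).add (hK.tendsto.mul hH.radial)
    rw [mul_zero, add_zero] at h
    refine h.congr' ((eventually_radialInfinity_gt rH).mono fun p hp => ?_)
    beta_reduce
    rw [dR_mul (differentiableAt_of_smooth (hH.smooth p hp))
      (differentiableAt_of_smooth (hK.smooth p hp))]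
    ring
  angular := by
    have h := (hH.tendsto.mul hK.angular).add (hK.tendsto.mul hH.angular)
    rw [mul_zero, add_zero] at h
    refine h.congr' ((eventually_radialInfinity_gt rH).mono fun p hp => ?_)
    rw [dTheta_mul (differentiableAt_of_smooth (hH.smooth p hp))
      (differentiableAt_of_smooth (hK.smooth p hp))]

lemma TendsToOne.inv {rH : ℝ} {H : ℝ × ℝ → ℝ} (hH : TendsToOne rH H)
    (h0 : ∀ p : ℝ × ℝ, rH < p.1 → H p ≠ 0) : TendsToOne rH (fun p => (H p)⁻¹) := by
  have hi : Tendsto (fun p => (H p)⁻¹) radialInfinity (𝓝 1) := by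
    simpa using hH.tendsto.inv₀ one_ne_zero
  have hd : ∀ p : ℝ × ℝ, rH < p.1 →
      fderiv ℝ (fun p => (H p)⁻¹) p = (-((H p)⁻¹ * (H p)⁻¹)) • fderiv ℝ H p := fun p hp => by
    have h := (hasDerivAt_inv (h0 p hp)).comp_hasFDerivAt p
      (differentiableAt_of_smooth (hH.smooth p hp)).hasFDerivAt
    refine h.fderiv.trans ?_
    congr 1
    rw [pow_two, mul_inv]
  refine ⟨fun p hp => (hH.smooth p hp).inv (h0 p hp), hi, ?_, ?_⟩
  · have h := ((hi.mul hi).neg).mul hH.radial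
    rw [mul_zero] at h
    refine h.congr' ((eventually_radialInfinity_gt rH).mono fun p hp => ?_)
    simp only [dR, hd p hp, smul_apply, smul_eq_mul]
    ring
  · have h := ((hi.mul hi).neg).mul hH.angular
    rw [mul_zero] at h
    refine h.congr' ((eventually_radialInfinity_gt rH).mono fun p hp => ?_)
    simp only [dTheta, hd p hp, smul_apply, smul_eq_mul]

lemma tendsToOne_of_expansion {rH c : ℝ} (hrH : 0 < rH) {f : ℝ → ℝ → ℝ}
    (hf : ∀ p : ℝ × ℝ, rH < p.1 → ContDiffAt ℝ ∞ (fun p : ℝ × ℝ => f p.1 p.2) p)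
    (hE : IsRemainder 2 (fun r θ => f r θ - (1 + c / r))) :
    TendsToOne rH (fun p => f p.1 p.2) where
  smooth := hf
  tendsto := by
    have h := ((hE.tendsto_sub (e := fun r _ => 1 + c / r) (n := 0) (by norm_num)).add_const
      1).add (tendsto_const_div_radialInfinity c)
    rw [zero_add, add_zero] at h
    refine h.congr fun p => ?_
    ring
  radial := by
    have h := (hE.tendsto_dR (e := fun r _ => 1 + c / r) (e' := fun r _ => -c / r ^ 2) (n := 1)
      hf (fun r θ hr => ?_) (by norm_num)).add (tendsto_const_div_radialInfinity (-c))
    · rw [add_zero] at h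
      refine h.congr' ((eventually_radialInfinity_gt rH).mono fun p hp => ?_)
      have : p.1 ≠ 0 := (hrH.trans hp).ne'
      field_simp
      ring
    · simp only [div_eq_mul_inv]
      exact (((hasDerivAt_inv (hrH.trans hr).ne').const_mul c).const_add 1).congr_deriv (by ring)
  angular := by
    have h := hE.tendsto_dTheta (e := fun r _ => 1 + c / r) (e' := fun r _ => 0) (n := 0)
      hf (fun r θ hr => hasDerivAt_const _ _) (by norm_num)
    refine h.congr fun p => ?_
    simp

/-! ### Limits of the coefficients of the wave operator. -/

section Coefficients

variable {m : HTMetric} {rH ΩH M J : ℝ}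

lemma tendsToOne_N (hm : IsBlackHole m rH ΩH) (ha : IsAMC m M J) :
    TendsToOne rH (fun p => m.N p.1 p.2) := by
  refine tendsToOne_of_expansion (c := -M) hm.rH_pos (fun p hp => hm.contDiffAt_N hp) ?_
  convert ha.N_exp using 4
  ring

lemma tendsToOne_A (hm : IsBlackHole m rH ΩH) (ha : IsAMC m M J) :
    TendsToOne rH (fun p => m.A p.1 p.2) :=
  tendsToOne_of_expansion hm.rH_pos (fun _ hp => hm.contDiffAt_A hp) ha.A_exp

lemma tendsToOne_B (hm : IsBlackHole m rH ΩH) (ha : IsAMC m M J) :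
    TendsToOne rH (fun p => m.B p.1 p.2) := by
  refine tendsToOne_of_expansion (c := 0) hm.rH_pos (fun p hp => hm.contDiffAt_B hp) ?_
  convert ha.B_exp using 4
  ring

lemma tendsToOne_angularCoeff (hm : IsBlackHole m rH ΩH) (ha : IsAMC m M J) :
    TendsToOne rH m.angularCoeff :=
  (tendsToOne_N hm ha).mul (tendsToOne_A hm ha)

/-- The volume density divided by `r ^ 2 sin θ`. -/
lemma tendsToOne_volDensity (hm : IsBlackHole m rH ΩH) (ha : IsAMC m M J) :
    TendsToOne rH (fun p => m.N p.1 p.2 * m.A p.1 p.2 * (m.B p.1 p.2 * m.B p.1 p.2)) :=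
  ((tendsToOne_N hm ha).mul (tendsToOne_A hm ha)).mul
    ((tendsToOne_B hm ha).mul (tendsToOne_B hm ha))

lemma tendsToOne_radialCoeff (hm : IsBlackHole m rH ΩH) (ha : IsAMC m M J) :
    TendsToOne rH (fun p => m.N p.1 p.2 * (m.B p.1 p.2 * m.B p.1 p.2) * (m.A p.1 p.2)⁻¹) :=
  ((tendsToOne_N hm ha).mul ((tendsToOne_B hm ha).mul (tendsToOne_B hm ha))).mul
    ((tendsToOne_A hm ha).inv fun _ hp => (hm.pos _ _ hp).2.1.ne')

lemma tendsto_radialCoeff_div_sq (hm : IsBlackHole m rH ΩH) (ha : IsAMC m M J) :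
    Tendsto (fun p => m.radialCoeff p / p.1 ^ 2) radialInfinity (𝓝 1) := by
  refine (tendsToOne_radialCoeff hm ha).tendsto.congr'
    ((eventually_radialInfinity_gt rH).mono fun p hp => ?_)
  have : p.1 ≠ 0 := (hm.radius_pos hp).ne'
  simp only [HTMetric.radialCoeff]
  field_simp

lemma tendsto_dR_radialCoeff_div (hm : IsBlackHole m rH ΩH) (ha : IsAMC m M J) :
    Tendsto (fun p => dR m.radialCoeff p / p.1) radialInfinity (𝓝 2) := by
  have hK := tendsToOne_radialCoeff hm ha
  have h := (hK.tendsto.const_mul 2).add hK.radial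
  rw [mul_one, add_zero] at h
  refine h.congr' ((eventually_radialInfinity_gt rH).mono fun p hp => ?_)
  have h0 : p.1 ≠ 0 := (hm.radius_pos hp).ne'
  have e : m.radialCoeff = fun p => p.1 ^ 2 *
      (m.N p.1 p.2 * (m.B p.1 p.2 * m.B p.1 p.2) * (m.A p.1 p.2)⁻¹) := by
    ext p; simp only [HTMetric.radialCoeff, div_eq_mul_inv]; ring
  have d : dR (fun p : ℝ × ℝ => p.1 ^ 2) p = 2 * p.1 := by
    have hd := (hasDerivAt_dR (H := fun p : ℝ × ℝ => p.1 ^ 2) (r := p.1) (θ := p.2)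
      (contDiff_fst.pow 2).contDiffAt)
    simpa using hd.unique (hasDerivAt_pow 2 p.1)
  beta_reduce
  rw [e, dR_mul (H := fun p => p.1 ^ 2) (differentiableAt_fst.pow 2)
    (differentiableAt_of_smooth (hK.smooth p hp)), d]
  field_simp
  ring

end Coefficients

lemma AxisSymm.exists_abs_le {f : ℝ → ℝ} (hf : AxisSymm f) (hc : Continuous f) :
    ∃ C, ∀ θ, |f θ| ≤ C := by
  obtain ⟨C, hC⟩ := (isCompact_Icc (a := (0 : ℝ)) (b := 2 * Real.pi)).exists_bound_of_continuousOn
    hc.continuousOn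
  refine ⟨C, fun θ => ?_⟩
  obtain ⟨y, hy, hxy⟩ := Function.Periodic.exists_mem_Ico₀ (f := f) hf.2 Real.two_pi_pos θ
  rw [hxy]
  exact hC y ⟨hy.1, hy.2.le⟩

lemma tendsto_bounded_div {f : ℝ → ℝ} {C : ℝ} (hf : ∀ θ, |f θ| ≤ C) :
    Tendsto (fun p : ℝ × ℝ => f p.2 / p.1) radialInfinity (𝓝 0) := by
  refine squeeze_zero_norm' ?_ (tendsto_const_div_radialInfinity C)
  filter_upwards [eventually_radialInfinity_gt 0] with p hp
  rw [Real.norm_eq_abs, abs_div, abs_of_pos hp]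
  gcongr
  exact hf _

/-- Uniform convergence in `θ` passes to integrals over `[0, π]`. -/
lemma tendsto_integral_of_radialInfinity {F : ℝ × ℝ → ℝ} {L : ℝ → ℝ} {a : ℝ}
    (hF : ∀ p : ℝ × ℝ, a < p.1 → ContinuousAt F p) (hL : Continuous L)
    (h : Tendsto (fun p => F p - L p.2) radialInfinity (𝓝 0)) :
    Tendsto (fun r => ∫ θ in (0 : ℝ)..Real.pi, F (r, θ)) atTop
      (𝓝 (∫ θ in (0 : ℝ)..Real.pi, L θ)) := by
  rw [Metric.tendsto_atTop]
  intro δ hδ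
  have h1 := Metric.tendsto_nhds.1 h (δ / (2 * Real.pi)) (div_pos hδ Real.two_pi_pos)
  obtain ⟨u, hu, v, hv, huv⟩ := Filter.eventually_prod_iff.1 h1
  obtain ⟨R, hR⟩ := Filter.eventually_atTop.1 (hu.and (eventually_gt_atTop a))
  refine ⟨R, fun r hr => ?_⟩
  obtain ⟨hur, har⟩ := hR r hr
  have hc : Continuous fun θ => F (r, θ) := continuous_iff_continuousAt.2 fun θ =>
    ContinuousAt.comp (f := fun θ : ℝ => (r, θ)) (hF (r, θ) har) (by fun_prop)
  rw [Real.dist_eq, ← intervalIntegral.integral_sub (hc.intervalIntegrable _ _)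
    (hL.intervalIntegrable _ _), ← Real.norm_eq_abs]
  have hb := intervalIntegral.norm_integral_le_of_norm_le_const
    (f := fun θ => F (r, θ) - L θ) (a := 0) (b := Real.pi) (C := δ / (2 * Real.pi))
    fun θ _ => by
      have := huv hur (eventually_top.1 hv θ)
      rw [dist_zero_right] at this
      exact this.le
  refine hb.trans_lt ?_
  rw [sub_zero, abs_of_pos Real.pi_pos]
  have : δ / (2 * Real.pi) * Real.pi = δ / 2 := by field_simp
  rw [this]; linarith

/-! ## Angular equations -/

lemma eq_apply_zero_of_deriv_eq_zero {g g' : ℝ → ℝ} (hg : ∀ θ, HasDerivAt g (g' θ) θ)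
    (hz : ∀ θ ∈ Set.Ioo 0 Real.pi, g' θ = 0) {θ : ℝ} (hθ : θ ∈ Set.Icc 0 Real.pi) :
    g θ = g 0 := by
  rcases hθ.1.eq_or_lt with rfl | h0
  · rfl
  obtain ⟨c, hc, hs⟩ := exists_hasDerivAt_eq_slope g g' h0
    (fun x _ => (hg x).continuousAt.continuousWithinAt) fun x _ => hg x
  rw [hz c ⟨hc.1, hc.2.trans_le hθ.2⟩, eq_comm, div_eq_zero_iff] at hs
  rcases hs with hs | hs <;> linarith

lemma AxisSymm.eq_of_eqOn {f g : ℝ → ℝ} (hf : AxisSymm f) (hg : AxisSymm g)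
    (h : ∀ θ ∈ Set.Icc 0 Real.pi, f θ = g θ) (θ : ℝ) : f θ = g θ := by
  have hfg : Function.Periodic (fun θ => f θ - g θ) (2 * Real.pi) := fun θ => by
    simp only [hf.2, hg.2]
  obtain ⟨y, hy, hxy⟩ := hfg.exists_mem_Ico₀ Real.two_pi_pos θ
  have key : f y = g y := by
    rcases le_total y Real.pi with hy' | hy'
    · exact h y ⟨hy.1, hy'⟩
    · have h1 := h (-y + 2 * Real.pi) ⟨by linarith [hy.2], by linarith⟩
      rwa [hf.2, hg.2, hf.1, hg.1] at h1
  linarith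

lemma RegularAngular.hasDerivAt {f : ℝ → ℝ} (hf : RegularAngular f) (θ : ℝ) :
    HasDerivAt f (deriv f θ) θ :=
  (hf.1.differentiable (by simp) θ).hasDerivAt

lemma RegularAngular.hasDerivAt_deriv {f : ℝ → ℝ} (hf : RegularAngular f) (θ : ℝ) :
    HasDerivAt (deriv f) (deriv (deriv f) θ) θ :=
  (((contDiff_infty_iff_deriv.1 hf.1).2).differentiable (by simp) θ).hasDerivAt

/-- The regular solutions of `Δf = 0` on the sphere are the constants. -/
lemma RegularAngular.eq_const {f : ℝ → ℝ} (hf : RegularAngular f)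
    (h : ∀ θ ∈ Set.Ioo 0 Real.pi,
      Real.sin θ * deriv (deriv f) θ + Real.cos θ * deriv f θ = 0) (θ : ℝ) : f θ = f 0 := by
  have hd : ∀ θ ∈ Set.Ioo 0 Real.pi, deriv f θ = 0 := fun θ hθ => by
    -- The equation says `(sin θ f')' = 0`, and `sin θ f'` vanishes at `θ = 0`.
    have h1 := eq_apply_zero_of_deriv_eq_zero
      (fun θ => (Real.hasDerivAt_sin θ).mul (hf.hasDerivAt_deriv θ))
      (fun θ hθ => by linarith [h θ hθ]) (Set.Ioo_subset_Icc_self hθ)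
    simp only [Pi.mul_apply, Real.sin_zero, zero_mul] at h1
    exact (mul_eq_zero.1 h1).resolve_left (Real.sin_pos_of_pos_of_lt_pi hθ.1 hθ.2).ne'
  exact hf.2.eq_of_eqOn (g := fun _ => f 0) ⟨fun _ => rfl, fun _ => rfl⟩
    (fun θ hθ => eq_apply_zero_of_deriv_eq_zero hf.hasDerivAt hd hθ) θ

/-- The regular axisymmetric solutions of `Δf + 2 f = 0` on the sphere are the multiples of
`cos θ`. -/
lemma RegularAngular.eq_mul_cos {f : ℝ → ℝ} (hf : RegularAngular f)
    (h : ∀ θ ∈ Set.Ioo 0 Real.pi,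
      Real.sin θ * deriv (deriv f) θ + Real.cos θ * deriv f θ + 2 * Real.sin θ * f θ = 0)
    (θ : ℝ) : f θ = f 0 * Real.cos θ := by
  -- This is the Wronskian `W` of `f` with the solution `cos θ`. The equation gives `(sin θ W)' =
  -- 0`, and `sin θ W` vanishes at `θ = 0`.
  have hW : ∀ θ ∈ Set.Ioo 0 Real.pi, deriv f θ * Real.cos θ + f θ * Real.sin θ = 0 := by
    intro θ hθ
    have h1 := eq_apply_zero_of_deriv_eq_zero
      (fun θ => (Real.hasDerivAt_sin θ).mul (((hf.hasDerivAt_deriv θ).mul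
        (Real.hasDerivAt_cos θ)).add ((hf.hasDerivAt θ).mul (Real.hasDerivAt_sin θ))))
      (fun θ hθ => by
        simp only [Pi.add_apply, Pi.mul_apply]
        linear_combination Real.cos θ * h θ hθ) (Set.Ioo_subset_Icc_self hθ)
    simp only [Pi.mul_apply, Pi.add_apply, Real.sin_zero, zero_mul] at h1
    exact (mul_eq_zero.1 h1).resolve_left (Real.sin_pos_of_pos_of_lt_pi hθ.1 hθ.2).ne'
  -- A first integral once `W = 0`. Rotating the pair (this quantity, `W`) by the angle `θ` recovers
  -- `f`.
  have hc : ∀ θ ∈ Set.Icc 0 Real.pi, f θ * Real.cos θ - deriv f θ * Real.sin θ = f 0 := by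
    intro θ hθ
    have h1 := eq_apply_zero_of_deriv_eq_zero
      (fun θ => ((hf.hasDerivAt θ).mul (Real.hasDerivAt_cos θ)).sub
        ((hf.hasDerivAt_deriv θ).mul (Real.hasDerivAt_sin θ)))
      (fun θ hθ => by linear_combination -h θ hθ + hW θ hθ) hθ
    simpa using h1
  have hW' : ∀ θ ∈ Set.Icc 0 Real.pi, deriv f θ * Real.cos θ + f θ * Real.sin θ = 0 := by
    have hcl : Set.Icc 0 Real.pi ⊆
        {θ | deriv f θ * Real.cos θ + f θ * Real.sin θ = 0} := by
      rw [← closure_Ioo Real.pi_pos.ne]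
      refine closure_minimal hW (isClosed_eq ?_ continuous_const)
      have c1 : Continuous f := hf.1.continuous
      have c2 : Continuous (deriv f) :=
        continuous_iff_continuousAt.2 fun θ => (hf.hasDerivAt_deriv θ).continuousAt
      fun_prop
    exact hcl
  refine hf.2.eq_of_eqOn (g := fun θ => f 0 * Real.cos θ)
    ⟨fun θ => by simp, fun θ => by simp⟩ (fun θ hθ => ?_) θ
  linear_combination Real.cos θ * hc θ hθ + Real.sin θ * hW' θ hθ
    - f θ * Real.sin_sq_add_cos_sq θ

/-! ## The far-zone expansion of the scalar equation -/

/-- `√(-g) □U` in terms of second derivatives of `U`. -/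
lemma IsBlackHole.divergence_expand {m : HTMetric} {rH ΩH : ℝ} (hm : IsBlackHole m rH ΩH)
    {U : ℝ × ℝ → ℝ} {p : ℝ × ℝ} (hp : rH < p.1) (hU : ContDiffAt ℝ ∞ U p) :
    dR (m.radialFlux U) p + dTheta (m.angularFlux U) p
      = Real.sin p.2 * (m.radialCoeff p * dR (dR U) p + dR m.radialCoeff p * dR U p)
        + m.angularCoeff p * Real.sin p.2 * dTheta (dTheta U) p
        + (m.angularCoeff p * Real.cos p.2 + Real.sin p.2 * dTheta m.angularCoeff p)
            * dTheta U p := by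
  have dP := differentiableAt_of_smooth (hm.contDiffAt_radialCoeff hp)
  have dQ := differentiableAt_of_smooth (hm.contDiffAt_angularCoeff hp)
  have ds := differentiableAt_of_smooth (contDiffAt_sin_snd p)
  have s1 : dR (fun p : ℝ × ℝ => Real.sin p.2) p = 0 :=
    (hasDerivAt_dR (r := p.1) (θ := p.2) (contDiffAt_sin_snd p)).unique (hasDerivAt_const p.1 (Real.sin p.2))
  have s2 : dTheta (fun p : ℝ × ℝ => Real.sin p.2) p = Real.cos p.2 :=
    (hasDerivAt_dTheta (r := p.1) (θ := p.2) (contDiffAt_sin_snd p)).unique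
      (Real.hasDerivAt_sin _)
  have e1 : dR (m.radialFlux U) p = _ :=
    dR_mul (dP.mul ds) (differentiableAt_of_smooth (ContDiffAt.dR hU))
  have e2 : dTheta (m.angularFlux U) p = _ :=
    dTheta_mul (dQ.mul ds) (differentiableAt_of_smooth (ContDiffAt.dTheta hU))
  have e3 : dR (fun q : ℝ × ℝ => m.radialCoeff q * Real.sin q.2) p = _ := dR_mul dP ds
  have e4 : dTheta (fun q : ℝ × ℝ => m.angularCoeff q * Real.sin q.2) p = _ := dTheta_mul dQ ds
  rw [e1, e2, e3, e4, s1, s2]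
  ring

/-- The divergence is `-ε √(-g) *RR`, of order `r² · r^{-5}`, so one power of `r` is left over after
the factor `r²`. -/
lemma tendsto_sq_mul_divergence {m : HTMetric} {rH ΩH M J ε : ℝ} (hm : IsBlackHole m rH ΩH)
    (ha : IsAMC m M J) (hfall : FallsOff rH (pontryagin m.g)) {Φ : ℝ → ℝ → ℝ}
    (hΦ : RegularScalar rH Φ) (heq : SolvesDCS m rH ε Φ) {θ : ℝ} (hθ : θ ∈ Set.Ioo 0 Real.pi) :
    Tendsto (fun r => r ^ 2 * (dR (m.radialFlux fun p => Φ p.1 p.2) (r, θ)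
      + dTheta (m.angularFlux fun p => Φ p.1 p.2) (r, θ))) atTop (𝓝 0) := by
  obtain ⟨C, R, hR, hC⟩ := hfall
  have h1 := (tendsToOne_volDensity hm ha).tendsto.comp (tendsto_ray θ)
  have h2 : Tendsto (fun r : ℝ => r ^ 4 * pontryagin m.g ![0, r, θ, 0]) atTop (𝓝 0) := by
    refine squeeze_zero_norm' ?_ (tendsto_id.const_div_atTop C)
    filter_upwards [eventually_gt_atTop R, eventually_gt_atTop rH] with r hr hr'
    have h0 : 0 < r := hR.trans hr
    have := hC ![0, r, θ, 0] ⟨hr', hθ.1, hθ.2⟩ hr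
    rw [Real.norm_eq_abs, abs_mul, abs_of_pos (pow_pos h0 4)]
    calc _ ≤ r ^ 4 * (C / r ^ 5) := mul_le_mul_of_nonneg_left this (by positivity)
      _ = C / id r := by simp only [id]; field_simp
  have h3 := (h1.mul h2).const_mul (-ε * Real.sin θ)
  rw [mul_zero, mul_zero] at h3
  refine h3.congr' ((eventually_gt_atTop rH).mono fun r hr => ?_)
  have hx : ![0, r, θ, 0] ∈ exterior rH := ⟨hr, hθ.1, hθ.2⟩
  have hb := hm.volDensity_mul_box_of_regular hΦ hx
  have he := heq _ hx
  rw [hm.volDensity_eq hx.1] at hb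
  simp only [Matrix.cons_val, abs_of_pos (Real.sin_pos_of_pos_of_lt_pi hθ.1 hθ.2)] at hb
  simp only [Function.comp]
  rw [← hb, eq_neg_of_add_eq_zero_left he]
  ring

/-- The equation satisfied by the leading coefficient of `Φ ~ c(θ) r^{-k}`, `k = 1, 2`, in terms
of the limits `c`, `c'`, `c''` of the rescaled derivatives. -/
lemma leading_equation {m : HTMetric} {rH ΩH M J ε : ℝ} (hm : IsBlackHole m rH ΩH)
    (ha : IsAMC m M J) (hfall : FallsOff rH (pontryagin m.g)) {Φ : ℝ → ℝ → ℝ}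
    (hΦ : RegularScalar rH Φ) (heq : SolvesDCS m rH ε Φ) {θ : ℝ} (hθ : θ ∈ Set.Ioo 0 Real.pi)
    {k : ℕ} (hk : k ≤ 2) {a b c d : ℝ}
    (hr : Tendsto (fun r => r ^ (k + 1) * dR (fun p => Φ p.1 p.2) (r, θ)) atTop (𝓝 a))
    (hrr : Tendsto (fun r => r ^ (k + 2) * dR (dR fun p => Φ p.1 p.2) (r, θ)) atTop (𝓝 b))
    (ht : Tendsto (fun r => r ^ k * dTheta (fun p => Φ p.1 p.2) (r, θ)) atTop (𝓝 c))
    (htt : Tendsto (fun r => r ^ k * dTheta (dTheta fun p => Φ p.1 p.2) (r, θ)) atTop (𝓝 d)) :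
    Real.sin θ * d + Real.cos θ * c + Real.sin θ * (b + 2 * a) = 0 := by
  have hP := (tendsto_radialCoeff_div_sq hm ha).comp (tendsto_ray θ)
  have hP' := (tendsto_dR_radialCoeff_div hm ha).comp (tendsto_ray θ)
  have hQ := (tendsToOne_angularCoeff hm ha).tendsto.comp (tendsto_ray θ)
  have hQ' := (tendsToOne_angularCoeff hm ha).angular.comp (tendsto_ray θ)
  have h1 := ((((hP.mul hrr).add (hP'.mul hr)).const_mul (Real.sin θ)).add
    ((hQ.mul_const (Real.sin θ)).mul htt)).add
      (((hQ.mul_const (Real.cos θ)).add (hQ'.const_mul (Real.sin θ))).mul ht)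
  -- Lowers the weight from `r²` to `r^k`. For `k = 2` this limit is `1`, which is harmless because
  -- it multiplies a limit that is `0`.
  have hinv : Tendsto (fun r : ℝ => (r⁻¹) ^ (2 - k)) atTop (𝓝 ((0 : ℝ) ^ (2 - k))) :=
    tendsto_inv_atTop_zero.pow _
  have h2 := hinv.mul (tendsto_sq_mul_divergence hm ha hfall hΦ heq hθ)
  rw [mul_zero] at h2
  have h3 := tendsto_nhds_unique h1 (h2.congr' ?_)
  · linear_combination h3
  filter_upwards [eventually_gt_atTop rH] with r hr0
  have hr1 : r ≠ 0 := (hm.radius_pos hr0).ne'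
  rw [hm.divergence_expand (p := (r, θ)) hr0 (hΦ.contDiffAt (p := (r, θ)) hr0)]
  have e : (r⁻¹) ^ (2 - k) * r ^ 2 = r ^ k := by
    interval_cases k <;> simp <;> field_simp
  rw [← mul_assoc, e]
  simp only [Function.comp]
  field_simp
  ring

lemma hasDerivAt_const_div_pow (c : ℝ) (k : ℕ) {r : ℝ} (hr : r ≠ 0) :
    HasDerivAt (fun s => c / s ^ k) (-(k * c) / r ^ (k + 1)) r := by
  refine ((hasDerivAt_const r c).div (hasDerivAt_pow k r) (pow_ne_zero k hr)).congr_deriv ?_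
  rcases k with _ | k
  · simp
  · simp only [Nat.add_sub_cancel]
    field_simp
    ring

lemma hasDerivAt_two_term (a b : ℝ) {r : ℝ} (hr : r ≠ 0) :
    HasDerivAt (fun s => a / s + b / s ^ 2) (-a / r ^ 2 + -(2 * b) / r ^ 3) r := by
  have h := (hasDerivAt_const_div_pow a 1 hr).add (hasDerivAt_const_div_pow b 2 hr)
  simp only [pow_one, Nat.cast_one, one_mul, Nat.cast_ofNat] at h
  exact h

/-! ### Rescaled derivatives of the scalar, and its first two coefficients. -/

section FarZone

variable {rH : ℝ} {Φ : ℝ → ℝ → ℝ} {μ₁ μ₂ : ℝ → ℝ}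

/-- The growing term `μ₁ r` stays in the comparison function of this and the next lemmas, so that
one statement serves both orders: divided by `r` it isolates `μ₁`, and with `μ₁ = 0` it isolates
`μ₂`. -/
lemma tendsto_sq_mul_of_expansion
    (hexp : IsRemainder 3 (fun r θ => Φ r θ - (μ₁ θ / r + μ₂ θ / r ^ 2))) :
    Tendsto (fun p : ℝ × ℝ => p.1 ^ 2 * Φ p.1 p.2 - (μ₁ p.2 * p.1 + μ₂ p.2))
      radialInfinity (𝓝 0) := by
  refine (hexp.tendsto_sub (e := fun r θ => μ₁ θ / r + μ₂ θ / r ^ 2) (n := 2)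
    (by norm_num)).congr' ((eventually_radialInfinity_gt 0).mono fun p hp => ?_)
  have := hp.ne'
  field_simp

lemma tendsto_dR_of_expansion (hrH : 0 < rH) (hΦ : RegularScalar rH Φ)
    (hexp : IsRemainder 3 (fun r θ => Φ r θ - (μ₁ θ / r + μ₂ θ / r ^ 2))) :
    Tendsto (fun p : ℝ × ℝ => p.1 ^ 3 * dR (fun p => Φ p.1 p.2) p + (μ₁ p.2 * p.1 + 2 * μ₂ p.2))
      radialInfinity (𝓝 0) := by
  refine (hexp.tendsto_dR (e := fun r θ => μ₁ θ / r + μ₂ θ / r ^ 2)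
    (e' := fun r θ => -μ₁ θ / r ^ 2 + -(2 * μ₂ θ) / r ^ 3) (n := 3)
    (fun p hp => hΦ.contDiffAt hp) (fun r θ hr => ?_) (by norm_num)).congr'
    ((eventually_radialInfinity_gt 0).mono fun p hp => ?_)
  · exact hasDerivAt_two_term _ _ (hrH.trans hr).ne'
  · have := hp.ne'
    field_simp
    ring

lemma tendsto_dR_dR_of_expansion (hrH : 0 < rH) (hΦ : RegularScalar rH Φ)
    (hexp : IsRemainder 3 (fun r θ => Φ r θ - (μ₁ θ / r + μ₂ θ / r ^ 2))) :
    Tendsto (fun p : ℝ × ℝ => p.1 ^ 4 * dR (dR fun p => Φ p.1 p.2) p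
      - (2 * μ₁ p.2 * p.1 + 6 * μ₂ p.2)) radialInfinity (𝓝 0) := by
  refine (hexp.tendsto_dR_dR (e := fun r θ => μ₁ θ / r + μ₂ θ / r ^ 2)
    (e' := fun r θ => -μ₁ θ / r ^ 2 + -(2 * μ₂ θ) / r ^ 3)
    (e'' := fun r θ => 2 * μ₁ θ / r ^ 3 + 6 * μ₂ θ / r ^ 4) (n := 4)
    (fun p hp => hΦ.contDiffAt hp) (fun r θ hr => ?_) (fun r θ hr => ?_) (by norm_num)).congr'
    ((eventually_radialInfinity_gt 0).mono fun p hp => ?_)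
  · exact hasDerivAt_two_term _ _ (hrH.trans hr).ne'
  · refine ((hasDerivAt_const_div_pow (-μ₁ θ) 2 (hrH.trans hr).ne').add
      (hasDerivAt_const_div_pow (-(2 * μ₂ θ)) 3 (hrH.trans hr).ne')).congr_deriv ?_
    push_cast
    ring
  · have := hp.ne'
    field_simp

lemma tendsto_dTheta_of_expansion (hΦ : RegularScalar rH Φ) (hμ₁ : RegularAngular μ₁)
    (hμ₂ : RegularAngular μ₂)
    (hexp : IsRemainder 3 (fun r θ => Φ r θ - (μ₁ θ / r + μ₂ θ / r ^ 2))) :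
    Tendsto (fun p : ℝ × ℝ => p.1 ^ 2 * dTheta (fun p => Φ p.1 p.2) p
      - (deriv μ₁ p.2 * p.1 + deriv μ₂ p.2)) radialInfinity (𝓝 0) := by
  refine (hexp.tendsto_dTheta (e := fun r θ => μ₁ θ / r + μ₂ θ / r ^ 2)
    (e' := fun r θ => deriv μ₁ θ / r + deriv μ₂ θ / r ^ 2) (n := 2)
    (fun p hp => hΦ.contDiffAt hp)
    (fun r θ _ => ((hμ₁.hasDerivAt θ).div_const _).add ((hμ₂.hasDerivAt θ).div_const _))
    (by norm_num)).congr'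
    ((eventually_radialInfinity_gt 0).mono fun p hp => ?_)
  have := hp.ne'
  field_simp

lemma tendsto_dTheta_dTheta_of_expansion (hΦ : RegularScalar rH Φ) (hμ₁ : RegularAngular μ₁)
    (hμ₂ : RegularAngular μ₂)
    (hexp : IsRemainder 3 (fun r θ => Φ r θ - (μ₁ θ / r + μ₂ θ / r ^ 2))) :
    Tendsto (fun p : ℝ × ℝ => p.1 ^ 2 * dTheta (dTheta fun p => Φ p.1 p.2) p
      - (deriv (deriv μ₁) p.2 * p.1 + deriv (deriv μ₂) p.2)) radialInfinity (𝓝 0) := by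
  refine (hexp.tendsto_dTheta_dTheta (e := fun r θ => μ₁ θ / r + μ₂ θ / r ^ 2)
    (e' := fun r θ => deriv μ₁ θ / r + deriv μ₂ θ / r ^ 2)
    (e'' := fun r θ => deriv (deriv μ₁) θ / r + deriv (deriv μ₂) θ / r ^ 2) (n := 2)
    (fun p hp => hΦ.contDiffAt hp)
    (fun r θ _ => ((hμ₁.hasDerivAt θ).div_const _).add ((hμ₂.hasDerivAt θ).div_const _))
    (fun r θ _ => ((hμ₁.hasDerivAt_deriv θ).div_const _).add
      ((hμ₂.hasDerivAt_deriv θ).div_const _))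
    (by norm_num)).congr'
    ((eventually_radialInfinity_gt 0).mono fun p hp => ?_)
  have := hp.ne'
  field_simp

/-- Dropping one power of `r` in a limit along a ray. -/
lemma tendsto_of_tendsto_succ {n : ℕ} {F : ℝ × ℝ → ℝ} {a b θ : ℝ}
    (h : Tendsto (fun r => r ^ (n + 1) * F (r, θ) - (a * r + b)) atTop (𝓝 0)) :
    Tendsto (fun r => r ^ n * F (r, θ)) atTop (𝓝 a) := by
  have h1 := ((h.mul tendsto_inv_atTop_zero).add
    (tendsto_inv_atTop_zero.const_mul b)).const_add a
  rw [mul_zero, mul_zero, add_zero, add_zero] at h1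
  refine h1.congr' ((eventually_gt_atTop 0).mono fun r hr => ?_)
  have := hr.ne'
  field_simp
  ring

variable {m : HTMetric} {ΩH M J ε : ℝ}

/-- The radial operator `r² ∂_r² + 2 r ∂_r` annihilates `1/r`, which leaves `Δμ₁ = 0`. -/
lemma leading_coefficient_const (hm : IsBlackHole m rH ΩH)
    (ha : IsAMC m M J) (hfall : FallsOff rH (pontryagin m.g))
    (hΦ : RegularScalar rH Φ) (heq : SolvesDCS m rH ε Φ) (hμ₁ : RegularAngular μ₁)
    (hμ₂ : RegularAngular μ₂)
    (hexp : IsRemainder 3 (fun r θ => Φ r θ - (μ₁ θ / r + μ₂ θ / r ^ 2))) (θ : ℝ) :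
    μ₁ θ = μ₁ 0 := by
  refine hμ₁.eq_const (fun θ hθ => ?_) θ
  have h1 := ((tendsto_dR_of_expansion hm.rH_pos hΦ hexp).comp (tendsto_ray θ))
  have h2 := ((tendsto_dR_dR_of_expansion hm.rH_pos hΦ hexp).comp (tendsto_ray θ))
  have h3 := ((tendsto_dTheta_of_expansion hΦ hμ₁ hμ₂ hexp).comp (tendsto_ray θ))
  have h4 := ((tendsto_dTheta_dTheta_of_expansion hΦ hμ₁ hμ₂ hexp).comp (tendsto_ray θ))
  have l1 := tendsto_of_tendsto_succ (θ := θ) (n := 2) (F := dR fun p => Φ p.1 p.2) (a := -μ₁ θ)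
    (b := -(2 * μ₂ θ)) (h1.congr fun r => by simp only [Function.comp]; ring)
  have l2 := tendsto_of_tendsto_succ (θ := θ) (n := 3) (F := dR (dR fun p => Φ p.1 p.2)) (a := 2 * μ₁ θ)
    (b := 6 * μ₂ θ) (h2.congr fun r => rfl)
  have l3 := tendsto_of_tendsto_succ (θ := θ) (n := 1) (F := dTheta fun p => Φ p.1 p.2)
    (a := deriv μ₁ θ) (b := deriv μ₂ θ) (h3.congr fun r => rfl)
  have l4 := tendsto_of_tendsto_succ (θ := θ) (n := 1) (F := dTheta (dTheta fun p => Φ p.1 p.2))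
    (a := deriv (deriv μ₁) θ) (b := deriv (deriv μ₂) θ)
    (h4.congr fun r => rfl)
  have key := leading_equation hm ha hfall hΦ heq hθ (k := 1) (by norm_num) l1 l2 l3 l4
  linear_combination key

/-- The radial operator multiplies `r^{-2}` by `2`, the eigenvalue of `-Δ` at `ℓ = 1`. Had `μ₁` not
vanished, it would enter at this order through the `1/r` terms of the metric. -/
lemma subleading_coefficient_eq (hm : IsBlackHole m rH ΩH)
    (ha : IsAMC m M J) (hfall : FallsOff rH (pontryagin m.g))
    (hΦ : RegularScalar rH Φ) (heq : SolvesDCS m rH ε Φ) (hμ₁ : RegularAngular μ₁)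
    (hμ₂ : RegularAngular μ₂)
    (hexp : IsRemainder 3 (fun r θ => Φ r θ - (μ₁ θ / r + μ₂ θ / r ^ 2)))
    (h0 : ∀ θ, μ₁ θ = 0) (θ : ℝ) : μ₂ θ = μ₂ 0 * Real.cos θ := by
  have h0' : deriv μ₁ = fun _ => 0 := by rw [funext h0]; simp
  refine hμ₂.eq_mul_cos (fun θ hθ => ?_) θ
  have h1 := ((tendsto_dR_of_expansion hm.rH_pos hΦ hexp).comp (tendsto_ray θ))
  have h2 := ((tendsto_dR_dR_of_expansion hm.rH_pos hΦ hexp).comp (tendsto_ray θ))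
  have h3 := ((tendsto_dTheta_of_expansion hΦ hμ₁ hμ₂ hexp).comp (tendsto_ray θ))
  have h4 := ((tendsto_dTheta_dTheta_of_expansion hΦ hμ₁ hμ₂ hexp).comp (tendsto_ray θ))
  simp only [Function.comp_def, h0, h0', deriv_const, mul_zero, zero_mul, zero_add] at h1 h2 h3 h4
  have e : ∀ {F : ℝ → ℝ} {a : ℝ}, Tendsto (fun r => F r - a) atTop (𝓝 0) →
      Tendsto F atTop (𝓝 a) := fun h => tendsto_sub_nhds_zero_iff.1 h
  have key := leading_equation hm ha hfall hΦ heq hθ (k := 2) le_rfl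
    (e (a := -(2 * μ₂ θ)) (h1.congr fun r => by ring)) (e h2) (e h3) (e h4)
  linear_combination key

/-! ## Fluxes at infinity -/

lemma integral_sin_zero_pi : ∫ θ in (0 : ℝ)..Real.pi, Real.sin θ = 2 := by
  rw [integral_sin]; simp; norm_num

lemma integral_cos_sq_mul_sin : ∫ θ in (0 : ℝ)..Real.pi, Real.cos θ ^ 2 * Real.sin θ = 2 / 3 := by
  have h : ∀ θ ∈ Set.uIcc 0 Real.pi,
      HasDerivAt (fun θ => -(Real.cos θ ^ 3 / 3)) (Real.cos θ ^ 2 * Real.sin θ) θ := fun θ _ =>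
    ((((Real.hasDerivAt_cos θ).pow 3).div_const 3).neg).congr_deriv (by norm_num; ring)
  rw [intervalIntegral.integral_eq_sub_of_hasDerivAt h
    ((by fun_prop : Continuous fun θ => Real.cos θ ^ 2 * Real.sin θ).intervalIntegrable _ _)]
  norm_num

lemma integral_cos_mul_sin : ∫ θ in (0 : ℝ)..Real.pi, Real.cos θ * Real.sin θ = 0 := by
  have h : ∀ θ ∈ Set.uIcc 0 Real.pi,
      HasDerivAt (fun θ => -(Real.cos θ ^ 2 / 2)) (Real.cos θ * Real.sin θ) θ := fun θ _ =>
    ((((Real.hasDerivAt_cos θ).pow 2).div_const 2).neg).congr_deriv (by norm_num; ring)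
  rw [intervalIntegral.integral_eq_sub_of_hasDerivAt h
    ((by fun_prop : Continuous fun θ => Real.cos θ * Real.sin θ).intervalIntegrable _ _)]
  norm_num

lemma IsBlackHole.tendsto_flux (hm : IsBlackHole m rH ΩH) {v : ℝ → ℝ → ℝ}
    (hΦ : RegularScalar rH Φ) (hv : RegularScalar rH v) {L : ℝ → ℝ} (hL : Continuous L)
    (h : Tendsto (fun p : ℝ × ℝ => m.radialCoeff p * Real.sin p.2 *
      (v p.1 p.2 * dR (fun p => Φ p.1 p.2) p - Φ p.1 p.2 * dR (fun p => v p.1 p.2) p) - L p.2)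
      radialInfinity (𝓝 0)) :
    Tendsto (fun R => ∫ θ in (0 : ℝ)..Real.pi, m.radialCoeff (R, θ) * Real.sin θ *
        (v R θ * dR (fun p => Φ p.1 p.2) (R, θ) - Φ R θ * dR (fun p => v p.1 p.2) (R, θ)))
      atTop (𝓝 (∫ θ in (0 : ℝ)..Real.pi, L θ)) :=
  tendsto_integral_of_radialInfinity (a := rH)
    (F := fun p => m.radialCoeff p * Real.sin p.2 *
      (v p.1 p.2 * dR (fun p => Φ p.1 p.2) p - Φ p.1 p.2 * dR (fun p => v p.1 p.2) p))
    (fun p hp => (((hm.contDiffAt_radialCoeff hp).mul (contDiffAt_sin_snd p)).mul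
      (((hv.contDiffAt hp).mul (ContDiffAt.dR (hΦ.contDiffAt hp))).sub
        ((hΦ.contDiffAt hp).mul (ContDiffAt.dR (hv.contDiffAt hp))))).continuousAt) hL h

lemma tendsto_bounded_mul {b : ℝ → ℝ} (hb : ∀ θ, |b θ| ≤ 1) {E : ℝ × ℝ → ℝ}
    (hE : Tendsto E radialInfinity (𝓝 0)) :
    Tendsto (fun p => b p.2 * E p) radialInfinity (𝓝 0) := by
  refine squeeze_zero_norm (fun p => ?_) (tendsto_zero_iff_norm_tendsto_zero.1 hE)
  rw [norm_mul]
  exact mul_le_of_le_one_left (norm_nonneg _) (hb p.2)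

lemma regularScalar_one (rH : ℝ) : RegularScalar rH (fun _ _ => 1) :=
  ⟨⟨fun _ => 1, fun _ => 1, contDiff_const, fun _ _ _ => rfl, fun _ => rfl⟩,
    fun _ _ => ⟨fun _ => rfl, fun _ => rfl⟩⟩

lemma box_one (g : (Fin 4 → ℝ) → Matrix (Fin 4) (Fin 4) ℝ) (x : Fin 4 → ℝ) :
    box g (lift fun _ _ => 1) x = 0 := by
  have h : ∀ i x, pd i (lift fun _ _ => 1) x = 0 := fun i x => by
    have : lift (fun _ _ => 1) = fun _ => (1 : ℝ) := rfl
    simp [pd, this]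
  unfold box
  simp only [h, mul_zero, Finset.sum_const_zero]
  simp [pd]

/-- The total Pontryagin charge vanishes by the reflection symmetry, so `Φ` has no monopole. -/
lemma leading_coefficient_zero (hm : IsBlackHole m rH ΩH)
    (ha : IsAMC m M J) (hfall : FallsOff rH (pontryagin m.g))
    (hΦ : RegularScalar rH Φ) (heq : SolvesDCS m rH ε Φ) (hμ₁ : RegularAngular μ₁)
    (hμ₂ : RegularAngular μ₂)
    (hexp : IsRemainder 3 (fun r θ => Φ r θ - (μ₁ θ / r + μ₂ θ / r ^ 2))) (θ : ℝ) :
    μ₁ θ = 0 := by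
  have hc := leading_coefficient_const hm ha hfall hΦ heq hμ₁ hμ₂ hexp
  rw [hc θ]
  obtain ⟨G, -, hG, hflux⟩ := hm.exists_source_density hΦ heq (regularScalar_one rH)
    fun x _ => box_one _ x
  have hodd : ∀ r, rH < r → ∀ θ ∈ Set.Ioo 0 Real.pi, G (r, Real.pi - θ) = -G (r, θ) := by
    intro r hr θ hθ
    have hx : ![0, r, θ, 0] ∈ exterior rH := ⟨hr, hθ.1, hθ.2⟩
    have hre : reflect ![0, r, θ, 0] = ![0, r, Real.pi - θ, 0] := by
      ext i; fin_cases i <;> simp [reflect]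
    have hx' : reflect ![0, r, θ, 0] ∈ exterior rH := by
      rw [hre]
      have h1 := hθ.1
      have h2 := hθ.2
      exact ⟨hr, sub_pos.2 h2, sub_lt_self _ h1⟩
    have e1 := hG _ hx
    have e2 := hG _ hx'
    rw [hm.metricInvariant.volDensity hx.1, hm.metricInvariant.pontryagin _ hx.1] at e2
    rw [hre] at e2
    simp only [Matrix.cons_val, lift] at e1 e2
    rw [e1, e2]
    ring
  -- Substituting `θ ↦ π - θ` turns the integral into its own negative.
  have hzero : ∀ r, rH < r → ∫ θ in (0 : ℝ)..Real.pi, G (r, θ) = 0 := by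
    intro r hr
    have h1 := intervalIntegral.integral_comp_sub_left (a := 0) (b := Real.pi)
      (fun θ => G (r, θ)) Real.pi
    rw [intervalIntegral.integral_congr_Ioo_of_le Real.pi_pos.le (hodd r hr),
      intervalIntegral.integral_neg, sub_self, sub_zero] at h1
    linarith
  have hflux0 : ∀ R, rH < R → ∫ r in rH..R, ∫ θ in (0 : ℝ)..Real.pi, G (r, θ) = 0 := by
    intro R hR
    rw [intervalIntegral.integral_congr_Ioo_of_le (g := fun _ => 0) hR.le
      fun r hr => hzero r hr.1, intervalIntegral.integral_zero]
  obtain ⟨C, hC⟩ := hμ₂.2.exists_abs_le hμ₂.1.continuous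
  have hP := tendsto_radialCoeff_div_sq hm ha
  have h1 : Tendsto (fun p : ℝ × ℝ => p.1 ^ 2 * dR (fun p => Φ p.1 p.2) p)
      radialInfinity (𝓝 (-μ₁ 0)) := by
    have h := (((tendsto_dR_of_expansion hm.rH_pos hΦ hexp).mul
      (tendsto_const_div_radialInfinity 1)).sub
        ((tendsto_bounded_div hC).const_mul 2)).add_const (-μ₁ 0)
    rw [mul_zero, mul_zero, sub_zero, zero_add] at h
    refine h.congr' ((eventually_radialInfinity_gt 0).mono fun p hp => ?_)
    have := hp.ne'
    beta_reduce
    rw [hc p.2]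
    field_simp
    ring
  have h2 := hP.mul h1
  have h3 := tendsto_bounded_mul (fun θ => Real.abs_sin_le_one θ)
    (tendsto_sub_nhds_zero_iff.2 h2)
  have hd1 : ∀ p, dR (fun _ : ℝ × ℝ => (1 : ℝ)) p = 0 := fun p => by simp [dR]
  have hlim := hm.tendsto_flux hΦ (regularScalar_one rH) (L := fun θ => -μ₁ 0 * Real.sin θ)
    (by fun_prop) (h3.congr' ((eventually_radialInfinity_gt 0).mono fun p hp => by
      have := hp.ne'
      simp only [hd1]
      field_simp
      ring))
  rw [intervalIntegral.integral_const_mul, integral_sin_zero_pi] at hlim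
  have hlim0 := hlim.congr' (f₂ := fun _ => 0) ((eventually_gt_atTop rH).mono fun R hR => by
    have := hflux R hR
    rw [hflux0 R hR] at this
    linarith)
  have := tendsto_nhds_unique hlim0 tendsto_const_nhds
  linarith

/-! ### Legendre modes and the dipole flux. -/

lemma legendreP_zero (ξ : ℝ) : legendreP 0 ξ = 1 := by simp [legendreP]

lemma legendreP_one (ξ : ℝ) : legendreP 1 ξ = ξ := by
  simp [legendreP, iteratedDeriv_one]

lemma mode_zero_mul_cos (c : ℝ) : mode 0 (fun θ => c * Real.cos θ) = 0 := by
  simp only [mode, legendreP_zero, mul_one, mul_assoc, intervalIntegral.integral_const_mul,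
    integral_cos_mul_sin, mul_zero]

lemma mode_one_mul_cos (c : ℝ) : mode 1 (fun θ => c * Real.cos θ) = c := by
  have h : ∀ θ, c * Real.cos θ * legendreP 1 (Real.cos θ) * Real.sin θ
      = c * (Real.cos θ ^ 2 * Real.sin θ) := fun θ => by rw [legendreP_one]; ring
  simp only [mode, h, intervalIntegral.integral_const_mul, integral_cos_sq_mul_sin]
  push_cast
  ring

/-- Asymptotics of the Green solution. -/
lemma IsGreenSolution.tendsto {φ₀ : ℝ → ℝ → ℝ} (hφ : IsGreenSolution m rH φ₀) :
    Tendsto (fun p : ℝ × ℝ => φ₀ p.1 p.2 / p.1 - Real.cos p.2) radialInfinity (𝓝 0) ∧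
    Tendsto (fun p : ℝ × ℝ => dR (fun p => φ₀ p.1 p.2) p - Real.cos p.2)
      radialInfinity (𝓝 0) := by
  obtain ⟨ψ, hψ, hE⟩ := hφ.expansion
  simp only [legendreP_one] at hE
  obtain ⟨C, hC⟩ := hψ.2.exists_abs_le hψ.1.continuous
  constructor
  · have h := ((hE.tendsto_sub (e := fun r θ => r * Real.cos θ + ψ θ) (n := 0)
      (by norm_num)).mul (tendsto_const_div_radialInfinity 1)).add (tendsto_bounded_div hC)
    rw [mul_zero, add_zero] at h
    refine h.congr' ((eventually_radialInfinity_gt 0).mono fun p hp => ?_)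
    have := hp.ne'
    field_simp
    ring
  · have h := hE.tendsto_dR (e := fun r θ => r * Real.cos θ + ψ θ)
      (e' := fun r θ => Real.cos θ) (n := 0) (fun p hp => hφ.regular.contDiffAt hp)
      (fun r θ _ => by simpa using ((hasDerivAt_id r).mul_const (Real.cos θ)).add_const (ψ θ))
      (by norm_num)
    simpa using h

/-- The flux between `Φ` and the Green solution measures the dipole coefficient. -/
lemma tendsto_dipole_flux (hm : IsBlackHole m rH ΩH) (ha : IsAMC m M J)
    (hΦ : RegularScalar rH Φ) {c : ℝ}
    (hexp : IsRemainder 3 (fun r θ => Φ r θ - (0 / r + c * Real.cos θ / r ^ 2)))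
    {φ₀ : ℝ → ℝ → ℝ} (hφ : IsGreenSolution m rH φ₀) :
    Tendsto (fun R => ∫ θ in (0 : ℝ)..Real.pi, m.radialCoeff (R, θ) * Real.sin θ *
        (φ₀ R θ * dR (fun p => Φ p.1 p.2) (R, θ) - Φ R θ * dR (fun p => φ₀ p.1 p.2) (R, θ)))
      atTop (𝓝 (-(2 * c))) := by
  have E0 := tendsto_sub_nhds_zero_iff.2 (tendsto_radialCoeff_div_sq hm ha)
  have E1 := tendsto_sq_mul_of_expansion (μ₁ := fun _ => 0) hexp
  have E2 := tendsto_dR_of_expansion (μ₁ := fun _ => 0) hm.rH_pos hΦ hexp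
  obtain ⟨E3, E4⟩ := hφ.tendsto
  have hcos := fun θ => Real.abs_cos_le_one θ
  -- Write `E0, …, E4` for the errors in `P / r²`, `r² Φ`, `r³ ∂_r Φ`, `φ₀ / r`, `∂_r φ₀`. Then `r²
  -- (φ₀ ∂_r Φ - Φ ∂_r φ₀) = -3c cos² θ + S` with `S = cos θ S₁ + E3 E2 - E1 E4`. The factor `P / r²
  -- = 1 + E0` turns the error into `T₁ = -3c cos² θ E0 + (1 + E0) S`.
  have S₁ := ((E2.sub (E3.const_mul (2 * c))).sub (E4.const_mul c)).sub E1
  simp only [mul_zero, sub_zero] at S₁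
  have S := (tendsto_bounded_mul hcos S₁).add ((E3.mul E2).sub (E1.mul E4))
  have T₁ := ((tendsto_bounded_mul hcos (tendsto_bounded_mul hcos E0)).const_mul (-3 * c)).add
    ((E0.add_const 1).mul S)
  simp only [mul_zero, sub_zero, add_zero] at T₁
  have T := tendsto_bounded_mul (fun θ => Real.abs_sin_le_one θ) T₁
  have hlim := hm.tendsto_flux hΦ hφ.regular
    (L := fun θ => -3 * c * (Real.cos θ ^ 2 * Real.sin θ)) (by fun_prop)
    (T.congr' ((eventually_radialInfinity_gt 0).mono fun p hp => by
      have := hp.ne'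
      field_simp
      ring))
  rw [intervalIntegral.integral_const_mul, integral_cos_sq_mul_sin] at hlim
  convert hlim using 2
  ring

end FarZone

open MeasureTheory

/-! ## Integrals over slices -/

lemma exists_of_eventually_radialInfinity {P : ℝ × ℝ → Prop}
    (h : ∀ᶠ p in radialInfinity, P p) : ∃ R, ∀ r θ, R < r → P (r, θ) := by
  obtain ⟨u, hu, v, hv, huv⟩ := Filter.eventually_prod_iff.1 h
  obtain ⟨R, hR⟩ := Filter.eventually_atTop.1 hu
  exact ⟨R, fun r θ hr => huv (hR r hr.le) (eventually_top.1 hv θ)⟩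

lemma integrableOn_const_div_sq {a : ℝ} (ha : 0 < a) (D : ℝ) :
    IntegrableOn (fun r : ℝ => D / r ^ 2) (Set.Ioi a) := by
  have h := (integrableOn_Ioi_rpow_of_lt (a := -2) (by norm_num) ha).const_mul D
  refine IntegrableOn.congr_fun h (fun r hr => ?_) measurableSet_Ioi
  have hr0 : 0 < r := ha.trans hr
  rw [Real.rpow_neg hr0.le, div_eq_mul_inv]
  norm_num

/-- Domination by a function of `r` alone on a product with a set of finite measure. Applied with
`β` the `θ`-line for the source density and with `β` the `(θ, φ)`-plane for its weighted version. -/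
lemma integrableOn_of_le_div_sq {β : Type*} [TopologicalSpace β] [SecondCountableTopology β]
    [MeasureSpace β] [BorelSpace β] [SFinite (volume : Measure β)] {a : ℝ} (ha : 0 < a)
    {s : Set β} (hs : MeasurableSet s) (hs' : volume s < ⊤) {f : ℝ × β → ℝ}
    (hf : ContinuousOn f (Set.Ioi a ×ˢ s)) {D : ℝ}
    (hD : ∀ p ∈ Set.Ioi a ×ˢ s, |f p| ≤ D / p.1 ^ 2) :
    IntegrableOn f (Set.Ioi a ×ˢ s) := by
  have hms : MeasurableSet (Set.Ioi a ×ˢ s) := measurableSet_Ioi.prod hs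
  have : IsFiniteMeasure (volume.restrict s) := ⟨by simpa using hs'⟩
  have hint : IntegrableOn (fun p : ℝ × β => D / p.1 ^ 2) (Set.Ioi a ×ˢ s) := by
    rw [IntegrableOn, Measure.volume_eq_prod, ← Measure.prod_restrict]
    exact (integrableOn_const_div_sq ha D).comp_fst _
  exact Integrable.mono' hint (hf.aestronglyMeasurable hms)
    ((ae_restrict_iff' hms).2 (ae_of_all _ fun p hp => hD p hp))

/-- A bounded weight with unit mean over `φ` does not contribute to the integral over `Σ` of a
function of `(r, θ)`. -/
lemma integral_sliceDomain {a : ℝ} (ha : 0 < a) {G : ℝ × ℝ → ℝ} {j : ℝ × ℝ × ℝ → ℝ}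
    (hG : ContinuousOn G (Set.Ici a ×ˢ Set.univ)) {D K I : ℝ}
    (hD : ∀ r θ, a < r → θ ∈ Set.Ioo 0 Real.pi → |G (r, θ)| ≤ D / r ^ 2)
    (hj : ContinuousOn j (Set.Ioi a ×ˢ Set.Ioo 0 Real.pi ×ˢ Set.univ))
    (hK : ∀ p ∈ Set.Ioi a ×ˢ Set.Ioo 0 Real.pi ×ˢ Set.univ, |j p| ≤ K)
    (hmean : ∀ r θ, a < r → θ ∈ Set.Ioo 0 Real.pi →
      ∫ φ in (0 : ℝ)..2 * Real.pi, j (r, θ, φ) = 2 * Real.pi)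
    (hI : Tendsto (fun R => ∫ r in a..R, ∫ θ in (0 : ℝ)..Real.pi, G (r, θ)) atTop (𝓝 I)) :
    IntegrableOn (fun p : ℝ × ℝ × ℝ => G (p.1, p.2.1) * j p) (sliceDomain a) ∧
      ∫ p in sliceDomain a, G (p.1, p.2.1) * j p = 2 * Real.pi * I := by
  have hsub : sliceDomain a ⊆ Set.Ioi a ×ˢ Set.Ioo 0 Real.pi ×ˢ Set.univ := fun p hp =>
    ⟨hp.1, hp.2.1, trivial⟩
  have hcont : ContinuousOn (fun p : ℝ × ℝ × ℝ => G (p.1, p.2.1) * j p) (sliceDomain a) := by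
    refine ContinuousOn.mul (hG.comp (by fun_prop) fun p hp => ⟨Set.Ioi_subset_Ici_self hp.1, trivial⟩)
      (hj.mono hsub)
  have hbound : ∀ p ∈ sliceDomain a, |G (p.1, p.2.1) * j p| ≤ D * K / p.1 ^ 2 := by
    intro p hp
    rw [abs_mul, mul_div_right_comm]
    have h1 := hD p.1 p.2.1 hp.1 hp.2.1
    exact mul_le_mul h1 (hK p (hsub hp)) (abs_nonneg _) ((abs_nonneg _).trans h1)
  have hvol : volume (Set.Ioo 0 Real.pi ×ˢ Set.Ioo 0 (2 * Real.pi)) < ⊤ := by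
    rw [Measure.volume_eq_prod, Measure.prod_prod, Real.volume_Ioo, Real.volume_Ioo]
    exact ENNReal.mul_lt_top ENNReal.ofReal_lt_top ENNReal.ofReal_lt_top
  have hint : IntegrableOn (fun p : ℝ × ℝ × ℝ => G (p.1, p.2.1) * j p) (sliceDomain a) :=
    integrableOn_of_le_div_sq ha (measurableSet_Ioo.prod measurableSet_Ioo) hvol hcont hbound
  refine ⟨hint, ?_⟩
  have hGint : IntegrableOn G (Set.Ioi a ×ˢ Set.Ioo 0 Real.pi) :=
    integrableOn_of_le_div_sq ha measurableSet_Ioo (by simp)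
      (hG.mono fun p hp => ⟨Set.Ioi_subset_Ici_self hp.1, trivial⟩) fun p hp => hD p.1 p.2 hp.1 hp.2
  have hθ : ∀ f : ℝ → ℝ, ∫ θ in Set.Ioo 0 Real.pi, f θ = ∫ θ in (0 : ℝ)..Real.pi, f θ :=
    fun f => by rw [intervalIntegral.integral_of_le Real.pi_pos.le, integral_Ioc_eq_integral_Ioo]
  have hφ : ∀ f : ℝ → ℝ, ∫ φ in Set.Ioo 0 (2 * Real.pi), f φ
      = ∫ φ in (0 : ℝ)..2 * Real.pi, f φ := fun f => by
    rw [intervalIntegral.integral_of_le Real.two_pi_pos.le, integral_Ioc_eq_integral_Ioo]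
  have hradial : IntegrableOn (fun r => ∫ θ in (0 : ℝ)..Real.pi, G (r, θ)) (Set.Ioi a) := by
    rw [IntegrableOn, Measure.volume_eq_prod, ← Measure.prod_restrict] at hGint
    refine hGint.integral_prod_left.congr (ae_of_all _ fun r => ?_)
    exact hθ fun θ => G (r, θ)
  -- Absolute integrability identifies the limit of the truncated integrals with the Lebesgue
  -- integral.
  have hI' : ∫ r in Set.Ioi a, ∫ θ in (0 : ℝ)..Real.pi, G (r, θ) = I :=
    tendsto_nhds_unique (intervalIntegral_tendsto_integral_Ioi a hradial tendsto_id) hI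
  have hinner : ∀ r ∈ Set.Ioi a,
      ∫ q in Set.Ioo 0 Real.pi ×ˢ Set.Ioo 0 (2 * Real.pi), G (r, q.1) * j (r, q)
        = 2 * Real.pi * ∫ θ in (0 : ℝ)..Real.pi, G (r, θ) := by
    intro r hr
    have hq : IntegrableOn (fun q : ℝ × ℝ => G (r, q.1) * j (r, q))
        (Set.Ioo 0 Real.pi ×ˢ Set.Ioo 0 (2 * Real.pi)) := by
      have hms : MeasurableSet (Set.Ioo 0 Real.pi ×ˢ Set.Ioo 0 (2 * Real.pi)) :=
        measurableSet_Ioo.prod measurableSet_Ioo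
      have hc : ContinuousOn (fun q : ℝ × ℝ => G (r, q.1) * j (r, q))
          (Set.Ioo 0 Real.pi ×ˢ Set.Ioo 0 (2 * Real.pi)) :=
        hcont.comp (f := fun q : ℝ × ℝ => (r, q)) (by fun_prop) fun q hq => ⟨hr, hq⟩
      exact IntegrableOn.of_bound hvol (hc.aestronglyMeasurable hms) (D * K / r ^ 2)
        ((ae_restrict_iff' hms).2 (ae_of_all _ fun q hq => hbound (r, q) ⟨hr, hq⟩))
    rw [Measure.volume_eq_prod] at hq ⊢
    rw [setIntegral_prod _ hq, ← hθ, ← integral_const_mul]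
    refine setIntegral_congr_fun measurableSet_Ioo fun θ hθ' => ?_
    simp only
    rw [integral_const_mul, hφ, hmean r θ hr hθ', mul_comm]
  unfold sliceDomain at hint ⊢
  rw [Measure.volume_eq_prod] at hint ⊢
  rw [setIntegral_prod _ hint, setIntegral_congr_fun measurableSet_Ioi hinner,
    integral_const_mul, hI']

/-! ### The weight of a slice. -/

section Slice

variable {rH ΩH : ℝ} {h : ℝ → ℝ → ℝ → ℝ}

lemma isOpen_slice_coordinates (rH : ℝ) :
    IsOpen (Set.Ioi rH ×ˢ Set.Ioo 0 Real.pi ×ˢ (Set.univ : Set ℝ)) :=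
  isOpen_Ioi.prod (isOpen_Ioo.prod isOpen_univ)

lemma IsSlice.hasDerivAt (hh : IsSlice rH h) {p : ℝ × ℝ × ℝ}
    (hp : p ∈ Set.Ioi rH ×ˢ Set.Ioo 0 Real.pi ×ˢ (Set.univ : Set ℝ)) :
    HasDerivAt (h p.1 p.2.1)
      (fderiv ℝ (fun p : ℝ × ℝ × ℝ => h p.1 p.2.1 p.2.2) p (0, 0, 1)) p.2.2 := by
  have hd := (hh.smooth.contDiffAt ((isOpen_slice_coordinates rH).mem_nhds hp)).differentiableAt
    (by norm_num)
  exact hd.hasFDerivAt.comp_hasDerivAt p.2.2 (f := fun φ => (p.1, p.2.1, φ))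
    ((hasDerivAt_const _ _).prodMk ((hasDerivAt_const _ _).prodMk (hasDerivAt_id _)))

lemma IsSlice.continuousOn_deriv (hh : IsSlice rH h) :
    ContinuousOn (fun p : ℝ × ℝ × ℝ => deriv (h p.1 p.2.1) p.2.2)
      (Set.Ioi rH ×ˢ Set.Ioo 0 Real.pi ×ˢ (Set.univ : Set ℝ)) :=
  ((hh.smooth.continuousOn_fderiv_of_isOpen (isOpen_slice_coordinates rH)
    (by norm_num)).clm_apply continuousOn_const).congr fun _ hp => (hh.hasDerivAt hp).deriv

/-- `X` has no `r` or `θ` component, so contracting it with `∂_μ (t - h)` leaves `X(t - h) = 1 - ΩH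
∂_φ h`. -/
lemma IsSlice.fluxDensity_eq (hh : IsSlice rH h)
    (g : (Fin 4 → ℝ) → Matrix (Fin 4) (Fin 4) ℝ) (S : (Fin 4 → ℝ) → ℝ) {p : ℝ × ℝ × ℝ}
    (hp : p ∈ Set.Ioi rH ×ˢ Set.Ioo 0 Real.pi ×ˢ (Set.univ : Set ℝ)) :
    fluxDensity g ΩH h S p = S (slicePoint h p) * volDensity g (slicePoint h p)
      * (1 - ΩH * deriv (h p.1 p.2.1) p.2.2) := by
  have hd := (hh.smooth.contDiffAt ((isOpen_slice_coordinates rH).mem_nhds hp)).differentiableAt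
    (by norm_num)
  have hF : HasFDerivAt (fun y : Fin 4 → ℝ => y 0 - h (y 1) (y 2) (y 3))
      ((ContinuousLinearMap.proj 0 : (Fin 4 → ℝ) →L[ℝ] ℝ)
        - (fderiv ℝ (fun p : ℝ × ℝ × ℝ => h p.1 p.2.1 p.2.2) p).comp
          ((ContinuousLinearMap.proj 1 : (Fin 4 → ℝ) →L[ℝ] ℝ).prod
            ((ContinuousLinearMap.proj 2 : (Fin 4 → ℝ) →L[ℝ] ℝ).prod
              (ContinuousLinearMap.proj 3)))) (slicePoint h p) :=
    ((ContinuousLinearMap.proj 0 : (Fin 4 → ℝ) →L[ℝ] ℝ).hasFDerivAt).sub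
      (HasFDerivAt.comp (g := fun p : ℝ × ℝ × ℝ => h p.1 p.2.1 p.2.2) (slicePoint h p)
        hd.hasFDerivAt
        (((ContinuousLinearMap.proj 1 : (Fin 4 → ℝ) →L[ℝ] ℝ).prod
            ((ContinuousLinearMap.proj 2 : (Fin 4 → ℝ) →L[ℝ] ℝ).prod
              (ContinuousLinearMap.proj 3))).hasFDerivAt))
  have p0 : pd 0 (fun y : Fin 4 → ℝ => y 0 - h (y 1) (y 2) (y 3)) (slicePoint h p) = 1 := by
    have z : ((0, 0, 0) : ℝ × ℝ × ℝ) = 0 := rfl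
    rw [pd, hF.fderiv]; simp [z]
  have p3 : pd 3 (fun y : Fin 4 → ℝ => y 0 - h (y 1) (y 2) (y 3)) (slicePoint h p)
      = -deriv (h p.1 p.2.1) p.2.2 := by
    rw [pd, hF.fderiv, (hh.hasDerivAt hp).deriv]; simp
  unfold fluxDensity surfaceElement
  rw [Fin.sum_univ_four, p0, p3]
  simp
  ring

lemma IsSlice.integral_weight (hh : IsSlice rH h) {r θ : ℝ} (hr : rH < r)
    (hθ : θ ∈ Set.Ioo 0 Real.pi) :
    ∫ φ in (0 : ℝ)..2 * Real.pi, (1 - ΩH * deriv (h r θ) φ) = 2 * Real.pi := by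
  have hc : Continuous (deriv (h r θ)) := by
    rw [← continuousOn_univ]
    exact hh.continuousOn_deriv.comp (f := fun φ : ℝ => (r, θ, φ)) (by fun_prop)
      fun φ _ => ⟨hr, hθ, trivial⟩
  have hF := intervalIntegral.integral_eq_sub_of_hasDerivAt (a := 0) (b := 2 * Real.pi)
    (f := h r θ) (f' := deriv (h r θ))
    (fun φ _ => (hh.hasDerivAt (p := (r, θ, φ)) ⟨hr, hθ, trivial⟩).differentiableAt.hasDerivAt)
    (hc.intervalIntegrable _ _)
  have hper := hh.periodic r θ 0
  rw [zero_add] at hper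
  rw [hper, sub_self] at hF
  rw [intervalIntegral.integral_sub (by simp) ((hc.const_mul ΩH).intervalIntegrable _ _),
    intervalIntegral.integral_const_mul, hF]
  simp

end Slice

/-- The source density `ε √(-g) *RR φ₀` decays as `r^{-2}`. -/
lemma exists_source_bound {m : HTMetric} {rH ΩH M J ε : ℝ} (hm : IsBlackHole m rH ΩH)
    (ha : IsAMC m M J) (hfall : FallsOff rH (pontryagin m.g)) {φ₀ : ℝ → ℝ → ℝ}
    (hφ : IsGreenSolution m rH φ₀) {G : ℝ × ℝ → ℝ}
    (hG : ContinuousOn G (Set.Ici rH ×ˢ Set.univ))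
    (hGeq : ∀ x ∈ exterior rH, G (x 1, x 2)
        = ε * (pontryagin m.g x * lift φ₀ x) * volDensity m.g x) :
    ∃ D, ∀ r θ, rH < r → θ ∈ Set.Ioo 0 Real.pi → |G (r, θ)| ≤ D / r ^ 2 := by
  obtain ⟨C, R₀, hR₀, hC⟩ := hfall
  obtain ⟨R₁, h1⟩ := exists_of_eventually_radialInfinity
    (Metric.tendsto_nhds.1 hφ.tendsto.1 1 one_pos)
  obtain ⟨R₂, h2⟩ := exists_of_eventually_radialInfinity
    (Metric.tendsto_nhds.1 (tendsToOne_volDensity hm ha).tendsto 1 one_pos)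
  set R := max rH (max R₀ (max R₁ R₂)) with hR
  -- Near the horizon the bound comes from compactness, which relies on continuity of `G` up to `r =
  -- rH` and on the axis.
  obtain ⟨D₀, hD₀⟩ := ((isCompact_Icc (a := rH) (b := R)).prod
    (isCompact_Icc (a := (0 : ℝ)) (b := Real.pi))).exists_bound_of_continuousOn
      (hG.mono fun p hp => ⟨hp.1.1, trivial⟩)
  -- Beyond `R`, `φ₀ / r` and `√(-g) / (r² sin θ)` are each at most `2`, which is where the `4`
  -- comes from; the powers combine as `r^{-5} · r · r² = r^{-2}`.
  refine ⟨max (D₀ * R ^ 2) (4 * |ε| * |C|), fun r θ hr hθ => ?_⟩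
  have hr0 := hm.radius_pos hr
  rw [le_div_iff₀ (by positivity)]
  rcases le_or_gt r R with hle | hgt
  · refine le_trans ?_ (le_max_left _ _)
    have := hD₀ (r, θ) ⟨⟨hr.le, hle⟩, hθ.1.le, hθ.2.le⟩
    rw [Real.norm_eq_abs] at this
    exact mul_le_mul this (pow_le_pow_left₀ hr0.le hle 2) (by positivity)
      ((abs_nonneg _).trans this)
  · refine le_trans ?_ (le_max_right _ _)
    simp only [hR, max_lt_iff] at hgt
    have hx : ![0, r, θ, 0] ∈ exterior rH := ⟨hr, hθ.1, hθ.2⟩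
    have e := hGeq _ hx
    have b0 := hC _ hx hgt.2.1
    have b1 := h1 r θ hgt.2.2.1
    have b2 := h2 r θ hgt.2.2.2
    rw [hm.volDensity_eq hx.1] at e
    simp only [Matrix.cons_val, lift] at e b0
    rw [dist_zero_right, Real.norm_eq_abs] at b1
    rw [Real.dist_eq] at b2
    have c1 : |φ₀ r θ / r| ≤ 2 := by
      have := abs_add_le (φ₀ r θ / r - Real.cos θ) (Real.cos θ)
      rw [sub_add_cancel] at this
      linarith [Real.abs_cos_le_one θ]
    have c2 : |m.N r θ * m.A r θ * (m.B r θ * m.B r θ)| ≤ 2 := by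
      have := abs_add_le (m.N r θ * m.A r θ * (m.B r θ * m.B r θ) - 1) 1
      rw [sub_add_cancel, abs_one] at this
      linarith
    have c0 : |pontryagin m.g ![0, r, θ, 0] * r ^ 5| ≤ |C| := by
      rw [abs_mul, abs_of_pos (pow_pos hr0 5), ← le_div_iff₀ (by positivity)]
      exact b0.trans (by gcongr; exact le_abs_self C)
    have e' : G (r, θ) * r ^ 2 = ε * ((pontryagin m.g ![0, r, θ, 0] * r ^ 5) * ((φ₀ r θ / r) *
        ((m.N r θ * m.A r θ * (m.B r θ * m.B r θ)) * |Real.sin θ|))) := by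
      rw [e]; field_simp
    calc |G (r, θ)| * r ^ 2 = |G (r, θ) * r ^ 2| := by
          rw [abs_mul, abs_of_pos (pow_pos hr0 2)]
      _ ≤ |ε| * (|C| * (2 * (2 * 1))) := by
          rw [e', abs_mul ε, abs_mul (_ * r ^ 5), abs_mul (φ₀ r θ / r),
            abs_mul _ |Real.sin θ|, abs_abs]
          gcongr
          exact Real.abs_sin_le_one θ
      _ = 4 * |ε| * |C| := by ring

end DCS

/-! ### The dipole coefficient as an integral over a slice. -/

theorem mainTheorem8 (m : DCS.HTMetric) (rH ΩH M J ε : ℝ)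
    (hBH : DCS.IsBlackHole m rH ΩH) (hAMC : DCS.IsAMC m M J)
    (hfall : DCS.FallsOff rH (DCS.pontryagin m.g))
    (Φ : ℝ → ℝ → ℝ) (hreg : DCS.RegularScalar rH Φ) (heq : DCS.SolvesDCS m rH ε Φ)
    (μ₁ μ₂ : ℝ → ℝ) (hμ₁ : DCS.RegularAngular μ₁) (hμ₂ : DCS.RegularAngular μ₂)
    (hexp : DCS.IsRemainder 3 (fun r θ => Φ r θ - (μ₁ θ / r + μ₂ θ / r ^ 2))) :
    (∀ θ, μ₁ θ = 0) ∧
    DCS.mode 0 μ₂ = 0 ∧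
    (∀ θ, μ₂ θ = DCS.mode 1 μ₂ * DCS.legendreP 1 (Real.cos θ)) ∧
    DCS.IsRemainder 3
      (fun r θ => Φ r θ - DCS.mode 1 μ₂ * DCS.legendreP 1 (Real.cos θ) / r ^ 2) ∧
    ∀ φ₀ : ℝ → ℝ → ℝ, DCS.IsGreenSolution m rH φ₀ →
    ∀ h : ℝ → ℝ → ℝ → ℝ, DCS.IsSlice rH h →
      MeasureTheory.IntegrableOn
        (DCS.fluxDensity m.g ΩH h (fun x => ε * (DCS.pontryagin m.g x * DCS.lift φ₀ x)))
        (DCS.sliceDomain rH) ∧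
      DCS.mode 1 μ₂ = ε / (4 * Real.pi) *
        ∫ p in DCS.sliceDomain rH,
          DCS.fluxDensity m.g ΩH h (fun x => DCS.pontryagin m.g x * DCS.lift φ₀ x) p := by
  have h1 := DCS.leading_coefficient_zero hBH hAMC hfall hreg heq hμ₁ hμ₂ hexp
  have h2 := DCS.subleading_coefficient_eq hBH hAMC hfall hreg heq hμ₁ hμ₂ hexp h1
  -- With `μ₂ 0` made opaque, `h2` can be used as a rewrite rule without rewriting its own
  -- right-hand side.
  obtain ⟨c, hc⟩ : ∃ c, c = μ₂ 0 := ⟨_, rfl⟩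
  rw [← hc] at h2
  have hμ : μ₂ = fun θ => c * Real.cos θ := funext h2
  have hmode : DCS.mode 1 μ₂ = c := by rw [hμ, DCS.mode_one_mul_cos]
  have hexp' : DCS.IsRemainder 3 (fun r θ => Φ r θ - (0 / r + c * Real.cos θ / r ^ 2)) := by
    simpa only [h1, h2] using hexp
  rw [hmode]
  refine ⟨h1, by rw [hμ, DCS.mode_zero_mul_cos], fun θ => by rw [DCS.legendreP_one, h2], ?_, ?_⟩
  · simpa only [zero_div, zero_add, DCS.legendreP_one] using hexp'
  intro φ₀ hφ h hh
  obtain ⟨G, hGc, hG, hflux⟩ :=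
    hBH.exists_source_density hreg heq hφ.regular hφ.homogeneous
  obtain ⟨D, hD⟩ := DCS.exists_source_bound hBH hAMC hfall hφ hGc hG
  obtain ⟨K, hK⟩ := hh.bounded
  have hlim : Filter.Tendsto (fun R => ∫ r in rH..R, ∫ θ in (0 : ℝ)..Real.pi, G (r, θ))
      Filter.atTop (nhds (2 * c)) := by
    have hl := (DCS.tendsto_dipole_flux hBH hAMC hreg hexp' hφ).neg
    rw [neg_neg] at hl
    exact hl.congr' ((Filter.eventually_gt_atTop rH).mono fun R hR => (hflux R hR).symm)
  obtain ⟨hint, hval⟩ := DCS.integral_sliceDomain hBH.rH_pos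
    (j := fun p => 1 - ΩH * deriv (h p.1 p.2.1) p.2.2) (K := 1 + |ΩH| * K) hGc hD
    (continuousOn_const.sub (continuousOn_const.mul hh.continuousOn_deriv))
    (fun p hp => by
      refine (abs_sub _ _).trans ?_
      rw [abs_one, abs_mul]
      gcongr
      exact hK _ _ _ hp.1 hp.2.1.1 hp.2.1.2)
    (fun r θ hr hθ => hh.integral_weight hr hθ) hlim
  have hms : MeasurableSet (DCS.sliceDomain rH) :=
    measurableSet_Ioi.prod (measurableSet_Ioo.prod measurableSet_Ioo)
  -- The source density depends on `(r, θ)` only, so the height `h` of the slice enters solely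
  -- through the weight.
  have heqOn : Set.EqOn
      (DCS.fluxDensity m.g ΩH h (fun x => ε * (DCS.pontryagin m.g x * DCS.lift φ₀ x)))
      (fun p => G (p.1, p.2.1) * (1 - ΩH * deriv (h p.1 p.2.1) p.2.2))
      (DCS.sliceDomain rH) := fun p hp => by
    have hx : DCS.slicePoint h p ∈ DCS.exterior rH := ⟨hp.1, hp.2.1.1, hp.2.1.2⟩
    rw [hh.fluxDensity_eq _ _ ⟨hp.1, hp.2.1, trivial⟩, ← hG _ hx]
    rfl
  refine ⟨hint.congr_fun heqOn.symm hms, ?_⟩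
  have hscale : ∀ p, DCS.fluxDensity m.g ΩH h
      (fun x => ε * (DCS.pontryagin m.g x * DCS.lift φ₀ x)) p
      = ε * DCS.fluxDensity m.g ΩH h (fun x => DCS.pontryagin m.g x * DCS.lift φ₀ x) p :=
    fun p => by simp only [DCS.fluxDensity]; ring
  rw [← MeasureTheory.setIntegral_congr_fun hms heqOn] at hval
  simp only [hscale, MeasureTheory.integral_const_mul] at hval
  -- The slice integral, `ε` included, is `2π · 2c`, which the prefactor `1 / (4π)` turns into `c`.
  rw [div_mul_eq_mul_div, hval]
  field_simp
  ring
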